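/- **Setting.** Let $H=\sum_{i=1}^m v_iP_i$ with $v_i\in\{\pm1\}$ and sign-free $n$-qubit Paulis $P_i\in\{I,X,Y,Z\}^{\otimes n}$, not assumed to commute. Let $\mathrm{symp}(P)\in\mathbb F_2^{2n}$ be the vector whose bit $j\le n$ is $1$ iff $P$ acts on qubit $j$ as $X$ or $Y$, and whose bit $n+j$ is $1$ iff $P$ acts on qubit $j$ as $Z$ or $Y$. Let $B^{\top}\in\mathbb F_2^{2n\times m}$ be the matrix with columns $\mathrm{symp}(P_1),\dots,\mathrm{symp}(P_m)$, the parity check matrix of the symplectic code $\mathrm{Symp}(H)$. A *weight-$\ell$ decoding oracle* for $H$ is a unitary $\mathcal D$ on $m+2n$ qubits with $\mathcal D|\mathbf y\rangle|B^\top\mathbf y\rangle=|0\rangle|B^\top\mathbf y\rangle$ for all $\mathbf y\in\mathbb F_2^m$ of Hamming weight $|\mathbf y|\le\ell$. Let $G$ be the graph on $\{1,\dots,m\}$ in which $i$ and $j$ are adjacent iff $P_iP_j=-P_jP_i$. For $\boldsymbol\mu\in\mathbb Z_{\ge0}^m$ let $S(\boldsymbol\mu)$ be the set of words over $\{1,\dots,m\}$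 that contain each $i$ exactly $\mu_i$ times. For a word $\tau$ let $\mathrm{sgn}_G(\tau)=(-1)^{r}$, where $r$ is the number of pairs of positions $a<b$ with $\tau_a>\tau_b$ and $\tau_a,\tau_b$ adjacent in $G$. Put $$\alpha_G(\boldsymbol\mu)=\frac{\mu_1!\cdots\mu_m!}{|\boldsymbol\mu|!}\sum_{\tau\in S(\boldsymbol\mu)}\mathrm{sgn}_G(\tau),\qquad \beta_G^{(k)}(\mathbf y)=\sum_{\substack{|\boldsymbol\mu|=k\\ \boldsymbol\mu\equiv\mathbf y\ (\mathrm{mod}\ 2)}}\binom{k}{\boldsymbol\mu}\alpha_G(\boldsymbol\mu).$$ Let $|\Phi^n\rangle=2^{-n/2}\sum_{\mathbf x\in\mathbb F_2^n}|\mathbf x\rangle|\mathbf x\rangle$. **The algorithm.** It takes the classical description $(v_i,P_i)_i$ of $H$, an $m$-qubit register $A$ and two $n$-qubit registers $B,C$ initialized to $|0^n\rangle|0^n\rangle$, and does the following. 1. Prepare $|\Phi^n\rangle$ on $BC$. 2. Apply $Z$ to the $i$-th qubit of $A$ for each $i$ with $v_i=-1$. 3. Apply the operator product $\prod_{i=1}^m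 C^{(i)}P_i$ (factors in increasing order from left to right), where $C^{(i)}P_i$ is $P_i$ on $B$ controlled by the $i$-th qubit of $A$. 4. Apply the coherent Bell measurement to $BC$, a unitary that maps each $(P\otimes I)|\Phi^n\rangle$ to $|\mathrm{symp}(P)\rangle$ up to a phase depending only on $P$. 5. Apply the oracle $\mathcal D$ to $A$ and $BC$. 6. Apply the inverse of the unitary of step 4 to $BC$. It is carried out by a single program, the same for all inputs, built from loops over the terms $i$ and over the sites $j$, tests on the description of $H$, and the elementary gates Hadamard, $Z$ and controlled single-qubit Pauli. Every gate, oracle call, test, loop entry and loop iteration costs one step. **Theorem (main reduction, general case).** (a) *Running time.* If $m=\mathrm{poly}(n)$, then the algorithm runs in time $\mathrm{poly}(n)$: for every polynomial $a$ there is a polynomial $q$ such that the algorithm makes at most $q(n)$ steps whenever $m\le a(n)$. (b) *Correctness.* Let $\mathcal P(x)=\sum_k c_kx^k$ be a real polynomial of degree at most $\ell$, where $\ell\le m$, and let $\mathcal D$ be a weight-$\ell$ decoding oracle for $H$. Suppose that register $A$ initially holds the pilot state $$|\mathcal R^\ell(H)\rangle=\frac1{\mathcal N}\sum_{k=0}^{\ell}c_k\sum_{\mathbf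 y\in\mathbb F_2^m}\beta_G^{(k)}(\mathbf y)\,|\mathbf y\rangle,$$ where $\mathcal N\in\mathbb C\setminus\{0\}$ is a constant that makes this a unit vector (in particular, the sum is not zero). Then the algorithm calls $\mathcal D$ exactly once and ends in the state $$|0^m\rangle_A\otimes\tfrac1{\mathcal N}\,(\mathcal P(H)\otimes I)\,|\Phi^n\rangle_{BC}.$$ Moreover $\mathrm{Tr}[\mathcal P^2(H)]\neq0$, and the reduced density matrix of this final state on register $B$ is $$\rho_{\mathcal P}(H)=\frac{\mathcal P^2(H)}{\mathrm{Tr}[\mathcal P^2(H)]}.$$ -/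

import Mathlib

open scoped BigOperators Matrix

namespace HDQI

/-! ## Bit strings, Pauli operators and signed Pauli Hamiltonians -/

/-- Bit strings indexed by `ι`; they label the computational basis of a register with qubits `ι`. -/
abbrev Bits (ι : Type) : Type := ι → ZMod 2

/-- The four sign-free single-qubit Paulis. -/
inductive Pauli : Type
  | I
  | X
  | Y
  | Z
  deriving DecidableEq

/-- The matrix of a single-qubit Pauli in the computational basis `|0⟩, |1⟩`:
`I = [1, 0; 0, 1]`, `X = [0, 1; 1, 0]`, `Y = [0, -i; i, 0]`, `Z = [1, 0; 0, -1]`. -/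
noncomputable def Pauli.mat : Pauli → Matrix (ZMod 2) (ZMod 2) ℂ
  | .I => Matrix.of fun a b => if a = b then 1 else 0
  | .X => Matrix.of fun a b => if a = b then 0 else 1
  | .Y => Matrix.of fun a b => if a = b then 0 else if a = 0 then -Complex.I else Complex.I
  | .Z => Matrix.of fun a b => if a = b then (if a = 0 then 1 else -1) else 0

/-- The X-bit of a single-qubit Pauli: `1` for `X` and `Y`. -/
def Pauli.xBit : Pauli → ZMod 2
  | .I => 0
  | .X => 1
  | .Y => 1
  | .Z => 0

/-- The Z-bit of a single-qubit Pauli: `1` for `Z` and `Y`. -/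
def Pauli.zBit : Pauli → ZMod 2
  | .I => 0
  | .X => 0
  | .Y => 1
  | .Z => 1

/-- The `2 ^ n × 2 ^ n` matrix of the `n`-qubit Pauli operator `P 0 ⊗ ⋯ ⊗ P (n - 1)`. -/
noncomputable def pauliOp {n : ℕ} (P : Fin n → Pauli) :
    Matrix (Bits (Fin n)) (Bits (Fin n)) ℂ :=
  Matrix.of fun x y => ∏ j, (P j).mat (x j) (y j)

/-- Symplectic representation in `𝔽₂ ^ (2n)`: the first `n` bits (`Sum.inl`) record the X-part, the
last `n` bits (`Sum.inr`) the Z-part. -/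
def symp {n : ℕ} (P : Fin n → Pauli) : Bits (Fin n ⊕ Fin n) :=
  Sum.elim (fun j => (P j).xBit) (fun j => (P j).zBit)

/-- The data of a signed Pauli Hamiltonian `∑ i, v i • P i` with `m` terms on `n` qubits. -/
structure PauliHam (n m : ℕ) : Type where
  /-- the signs, in `{1, -1}` -/
  v : Fin m → ℤˣ
  /-- the Pauli strings -/
  P : Fin m → Fin n → Pauli

namespace PauliHam

variable {n m : ℕ}

/-- The signed term `v i • P i`. -/
noncomputable def term (H : PauliHam n m) (i : Fin m) :
    Matrix (Bits (Fin n)) (Bits (Fin n)) ℂ :=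
  (((H.v i : ℤ)) : ℂ) • pauliOp (H.P i)

/-- The Hamiltonian as a matrix. -/
noncomputable def op (H : PauliHam n m) : Matrix (Bits (Fin n)) (Bits (Fin n)) ℂ :=
  ∑ i, H.term i

/-- The `2n × m` parity check matrix `Bᵀ` of the symplectic code of `H`: column `i` is
`symp (P i)`. -/
def checkMatrix (H : PauliHam n m) : Matrix (Fin n ⊕ Fin n) (Fin m) (ZMod 2) :=
  Matrix.of fun r i => symp (H.P i) r

/-- The anticommutation graph of the terms of `H`. -/
def antiGraph (H : PauliHam n m) : SimpleGraph (Fin m) where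
  Adj i j := i ≠ j ∧ H.term i * H.term j = -(H.term j * H.term i)
  symm := ⟨fun i j h => ⟨h.1.symm, by rw [h.2, neg_neg]⟩⟩
  loopless := ⟨fun i h => h.1 rfl⟩

/-- `f(H)`, for a real polynomial `f`. -/
noncomputable def poly (H : PauliHam n m) (f : Polynomial ℝ) :
    Matrix (Bits (Fin n)) (Bits (Fin n)) ℂ :=
  Polynomial.aeval H.op f

/-- `ρ_f(H) = f(H)² / Tr f(H)²`. -/
noncomputable def rho (H : PauliHam n m) (f : Polynomial ℝ) :
    Matrix (Bits (Fin n)) (Bits (Fin n)) ℂ :=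
  ((H.poly f ^ 2).trace)⁻¹ • (H.poly f ^ 2)

end PauliHam

/-! ## Antisymmetry character, β-functions, pilot state -/

section Beta

variable {m : ℕ}

open Classical in
/-- The sign incurred by sorting the word `τ` (over the alphabet of the `m` variables) into
ascending order: `(-1)` to the number of pairs of positions that are out of order and carry
anticommuting (adjacent) variables. -/
noncomputable def sortSign (G : SimpleGraph (Fin m)) {k : ℕ} (τ : Fin k → Fin m) : ℝ :=
  (-1) ^ (Finset.univ.filter fun p : Fin k × Fin k =>
    p.1 < p.2 ∧ τ p.2 < τ p.1 ∧ G.Adj (τ p.1) (τ p.2)).card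

/-- The set `S(μ)` of words containing the `i`-th variable exactly `μ i` times. -/
def words (μ : Fin m → ℕ) : Finset (Fin (∑ i, μ i) → Fin m) :=
  Finset.univ.filter fun τ => ∀ i, (Finset.univ.filter fun a => τ a = i).card = μ i

/-- The antisymmetry character `α_G(μ)`: the average sorting sign over `S(μ)`, where
`|S(μ)| = |μ|! / (μ₁! ⋯ μₘ!)`. -/
noncomputable def antisymChar (G : SimpleGraph (Fin m)) (μ : Fin m → ℕ) : ℝ :=
  (∏ i, ((μ i).factorial : ℝ)) / ((∑ i, μ i).factorial : ℝ) * ∑ τ ∈ words μ, sortSign G τ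

/-- The β-function of order `k`: the sum over weak compositions `μ` of `k` with
`μ mod 2 = y` of the multinomial coefficient times `α_G(μ)`. -/
noncomputable def beta (G : SimpleGraph (Fin m)) (k : ℕ) (y : Bits (Fin m)) : ℝ :=
  ∑ μ ∈ (Finset.piAntidiag (Finset.univ : Finset (Fin m)) k).filter
      (fun μ => ∀ i, (μ i : ZMod 2) = y i),
    (Nat.multinomial Finset.univ μ : ℝ) * antisymChar G μ

end Beta

/-- The unnormalized pilot vector `∑ k ≤ ℓ, c k ∑ y, β_G^(k)(y) |y⟩`, where `f = ∑ k, c k x ^ k`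
and `G` is the anticommutation graph of `H`. -/
noncomputable def pilotVec {n m : ℕ} (H : PauliHam n m) (f : Polynomial ℝ) (ℓ : ℕ) :
    Bits (Fin m) → ℂ :=
  fun y => ((∑ k ∈ Finset.range (ℓ + 1), f.coeff k * beta H.antiGraph k y : ℝ) : ℂ)

/-! ## Quantum states and the decoding oracle -/

/-- The qubits: register `A` (`m` qubits, `Sum.inl`), and registers `B`, `C` (`n` qubits each,
`Sum.inr ∘ Sum.inl` and `Sum.inr ∘ Sum.inr`). -/
abbrev Qubit (n m : ℕ) : Type := Fin m ⊕ (Fin n ⊕ Fin n)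

/-- State vectors of a register with qubits `ι`. -/
abbrev StateVec (ι : Type) : Type := Bits ι → ℂ

/-- The computational basis state `|x⟩`. -/
def ket {ι : Type} [DecidableEq ι] [Fintype ι] (x : Bits ι) : StateVec ι := Pi.single x 1

/-- `D` is a weight-`ℓ` decoding oracle for `H`: a unitary on registers `A` and `BC` with
`D |y⟩|Bᵀ y⟩ = |0⟩|Bᵀ y⟩` for every `y` of Hamming weight at most `ℓ`. -/
def IsDecodingOracle {n m : ℕ} (H : PauliHam n m) (ℓ : ℕ)
    (D : Matrix (Bits (Qubit n m)) (Bits (Qubit n m)) ℂ) : Prop :=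
  D ∈ Matrix.unitaryGroup (Bits (Qubit n m)) ℂ ∧
    ∀ y : Bits (Fin m), hammingNorm y ≤ ℓ →
      D *ᵥ ket (Sum.elim y (H.checkMatrix *ᵥ y)) = ket (Sum.elim 0 (H.checkMatrix *ᵥ y))

/-- The maximally entangled state `|Φⁿ⟩ = 2^(-n/2) ∑ b, |b⟩_B |b⟩_C`. -/
noncomputable def maxEntangled (n : ℕ) : StateVec (Fin n ⊕ Fin n) :=
  fun s => if (fun j => s (Sum.inl j)) = (fun j => s (Sum.inr j))
    then (((Real.sqrt 2) ^ n : ℝ) : ℂ)⁻¹ else 0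

/-- `(M ⊗ I) ψ`, for a matrix `M` acting on register `B` and a state `ψ` of registers `BC`. -/
noncomputable def applyB {n : ℕ} (M : Matrix (Bits (Fin n)) (Bits (Fin n)) ℂ)
    (ψ : StateVec (Fin n ⊕ Fin n)) : StateVec (Fin n ⊕ Fin n) :=
  fun s => ∑ b, M (fun j => s (Sum.inl j)) b * ψ (Sum.elim b fun j => s (Sum.inr j))

/-- The product state `φ_A ⊗ χ_BC`. -/
def tensorABC {n m : ℕ} (φ : StateVec (Fin m)) (χ : StateVec (Fin n ⊕ Fin n)) :
    StateVec (Qubit n m) :=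
  fun x => φ (fun i => x (Sum.inl i)) * χ (fun r => x (Sum.inr r))

/-- The reduced density matrix of `|ψ⟩⟨ψ|` on register `B` (registers `A` and `C` traced out). -/
noncomputable def reducedB {n m : ℕ} (ψ : StateVec (Qubit n m)) :
    Matrix (Bits (Fin n)) (Bits (Fin n)) ℂ :=
  Matrix.of fun b b' => ∑ a : Bits (Fin m), ∑ c : Bits (Fin n),
    ψ (Sum.elim a (Sum.elim b c)) * star (ψ (Sum.elim a (Sum.elim b' c)))

/-! ## Quantum programs with classical control and a step count

A program is one finite piece of syntax, the same for all inputs. It has a term index `i` and a site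
index `j`, loops over all terms and over all sites, tests on the classical description
`(v, P)` of the Hamiltonian, elementary one- and two-qubit gates, and an oracle instruction. -/

/-- References to qubits: `A` is the qubit `A[i]`, `B` is `B[j]`, `C` is `C[j]`, for the current
values of the indices `i` and `j`. -/
inductive Ref : Type
  | A
  | B
  | C

/-- Elementary gates: Hadamard, `Z`, and controlled single-qubit Paulis
`ctrl σ control target`. -/
inductive Gate : Type
  | hadamard (q : Ref)
  | phaseFlip (q : Ref)
  | ctrl (σ : Pauli) (c t : Ref)

/-- Programs. -/
inductive Prog : Type
  | seq (p q : Prog)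
  | gate (g : Gate)
  | oracle
  /-- `for i := m - 1` down to `0` do `p` -/
  | forTerm (p : Prog)
  /-- `for j := n - 1` down to `0` do `p` -/
  | forSite (p : Prog)
  /-- if `v i = -1` then `p` -/
  | ifNeg (p : Prog)
  /-- if `P i` acts on qubit `j` as `σ` then `p` -/
  | ifPauli (σ : Pauli) (p : Prog)

section Semantics

variable {n m : ℕ}

/-- The qubit that a reference denotes; `none` if the index it uses has not been set. -/
def Ref.eval : Ref → Option (Fin m) → Option (Fin n) → Option (Qubit n m)
  | .A, i, _ => i.map Sum.inl
  | .B, _, j => j.map fun j => Sum.inr (Sum.inl j)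
  | .C, _, j => j.map fun j => Sum.inr (Sum.inr j)

/-- The one-qubit operator `U` on qubit `q`. -/
noncomputable def onQubit (U : Matrix (ZMod 2) (ZMod 2) ℂ) (q : Qubit n m)
    (ψ : StateVec (Qubit n m)) : StateVec (Qubit n m) :=
  fun x => ∑ b : ZMod 2, U (x q) b * ψ (Function.update x q b)

/-- The operator `U` on qubit `t`, controlled by the qubit `c`. -/
noncomputable def onQubitCtrl (U : Matrix (ZMod 2) (ZMod 2) ℂ) (c t : Qubit n m)
    (ψ : StateVec (Qubit n m)) : StateVec (Qubit n m) :=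
  fun x => if x c = 1 then onQubit U t ψ x else ψ x

/-- The Hadamard matrix `2^(-1/2) [1, 1; 1, -1]`. -/
noncomputable def hadamardMat : Matrix (ZMod 2) (ZMod 2) ℂ :=
  Matrix.of fun a b => ((Real.sqrt 2 : ℝ) : ℂ)⁻¹ * if a = 1 ∧ b = 1 then -1 else 1

/-- The action of a gate. A gate on an undefined qubit, or whose control is its target, does
nothing. -/
noncomputable def Gate.apply (g : Gate) (i : Option (Fin m)) (j : Option (Fin n))
    (ψ : StateVec (Qubit n m)) : StateVec (Qubit n m) :=
  match g with
  | .hadamard q =>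
    match q.eval i j with
    | some q => onQubit hadamardMat q ψ
    | none => ψ
  | .phaseFlip q =>
    match q.eval i j with
    | some q => onQubit Pauli.Z.mat q ψ
    | none => ψ
  | .ctrl σ c t =>
    match c.eval i j, t.eval i j with
    | some c, some t => if c = t then ψ else onQubitCtrl σ.mat c t ψ
    | _, _ => ψ

/-- A machine configuration: the state of the qubits, the number of elementary steps made so far,
and the number of oracle calls made so far. -/
structure Machine (n m : ℕ) : Type where
  /-- the quantum state -/
  ψ : StateVec (Qubit n m)
  /-- elementary steps so far -/
  time : ℕ
  /-- oracle calls so far -/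
  calls : ℕ

/-- One step of classical control. -/
def Machine.tick (M : Machine n m) : Machine n m := ⟨M.ψ, M.time + 1, M.calls⟩

/-- Execution of a program, with the Hamiltonian `H` as classical input and access to the oracle
`D`. Every gate, oracle call, test, loop entry and loop iteration costs one step. -/
noncomputable def Prog.exec (H : PauliHam n m)
    (D : Matrix (Bits (Qubit n m)) (Bits (Qubit n m)) ℂ) :
    Prog → Option (Fin m) → Option (Fin n) → Machine n m → Machine n m
  | .seq p q, i, j, M => q.exec H D i j (p.exec H D i j M)
  | .gate g, i, j, M => ⟨g.apply i j M.ψ, M.time + 1, M.calls⟩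
  | .oracle, _, _, M => ⟨D *ᵥ M.ψ, M.time + 1, M.calls + 1⟩
  | .forTerm p, _, j, M =>
    (List.finRange m).reverse.foldl (fun M i => p.exec H D (some i) j M.tick) M.tick
  | .forSite p, i, _, M =>
    (List.finRange n).reverse.foldl (fun M j => p.exec H D i (some j) M.tick) M.tick
  | .ifNeg p, i, j, M =>
    match i with
    | some i' => if H.v i' = -1 then p.exec H D i j M.tick else M.tick
    | none => M.tick
  | .ifPauli σ p, i, j, M =>
    match i, j with
    | some i', some j' => if H.P i' j' = σ then p.exec H D i j M.tick else M.tick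
    | _, _ => M.tick

/-- Run a program from the initial state `ψ`. -/
noncomputable def Prog.run (p : Prog) (H : PauliHam n m)
    (D : Matrix (Bits (Qubit n m)) (Bits (Qubit n m)) ℂ) (ψ : StateVec (Qubit n m)) :
    Machine n m :=
  p.exec H D none none ⟨ψ, 0, 0⟩

end Semantics

/-! ## Hamiltonian decoded quantum interferometry -/

/-- Controlled-NOT. -/
def cnot (c t : Ref) : Prog := .gate (.ctrl .X c t)

/-- Swap `B[j]` and `C[j]`. -/
def swapBC : Prog := .seq (cnot .B .C) (.seq (cnot .C .B) (cnot .B .C))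

/-- Turn `|0ⁿ⟩_B |0ⁿ⟩_C` into the maximally entangled state. -/
def preparePhi : Prog := .forSite (.seq (.gate (.hadamard .B)) (cnot .B .C))

/-- Apply `Z` to the qubit `A[i]` for each `i` with `v i = -1`. -/
def applySigns : Prog := .forTerm (.ifNeg (.gate (.phaseFlip .A)))

/-- Apply the operator product `∏ i, C^(i) P_i` from `A` to `B`, in increasing order of `i` from left
to right: the factor with the largest `i` acts first, and the loop runs downwards. -/
def controlledPaulis : Prog :=
  .forTerm (.forSite
    (.seq (.ifPauli .X (.gate (.ctrl .X .A .B)))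
    (.seq (.ifPauli .Y (.gate (.ctrl .Y .A .B)))
      (.ifPauli .Z (.gate (.ctrl .Z .A .B))))))

/-- Coherent Bell measurement of `BC`: maps each Bell state `(P ⊗ I)|Φⁿ⟩` to `|symp P⟩`, up to a
phase that depends only on `P`. -/
def bellMeasure : Prog :=
  .forSite (.seq (cnot .B .C) (.seq (.gate (.hadamard .B)) swapBC))

/-- The inverse of `bellMeasure`. -/
def bellUnmeasure : Prog :=
  .forSite (.seq swapBC (.seq (.gate (.hadamard .B)) (cnot .B .C)))

/-- The algorithm. The output is register `B` (or registers `BC`, for the purification). -/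
def hdqi : Prog :=
  .seq preparePhi (.seq applySigns (.seq controlledPaulis
    (.seq bellMeasure (.seq .oracle bellUnmeasure))))

end HDQI

open HDQI

/-! Let T_y be the product, in increasing order, of the signed terms selected by `y` (`termProd`).
Two facts about the T_y meet.

The circuit turns the basis input |y⟩ into T_y. The signs and controlled Paulis leave |y⟩ on `A` and
put (T_y ⊗ I)|Φⁿ⟩ on `BC`. Site by site, T_y is a unimodular phase times X^x Z^z with exponents read
from Bᵀy, so the Bell measurement yields a phase times |Bᵀy⟩. If |y| ≤ ℓ the oracle clears `A`, and
undoing the measurement restores (T_y ⊗ I)|Φⁿ⟩, phase included (`IsDecodingOracle.hdqi_act_ket`).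

The powers of H expand in the same operators. H^k is a sum over words of length k. Sorting a word
costs one sign per inversion of anticommuting letters, and pairs of equal letters then cancel
because each term squares to 1. What remains is T_y, with y the parity vector of the word.
Collecting words by parity gives H^k = ∑ β^(k)(y) T_y (`op_pow_eq_sum_beta`), so the pilot
amplitudes are, up to N, the coefficients of f(H) in the T_y. They vanish for |y| > ℓ, so by
linearity the oracle's promise suffices (`IsDecodingOracle.hdqi_act_pilot`).

For the reduced state, unitarity forces distinct syndromes on inputs of weight at most ℓ. The
corresponding T_y are orthogonal in the trace inner product with squared norm 2^n, hence |N|⁻² Tr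
f(H)² = 2^n ∑ |R y|² = 2^n (`IsDecodingOracle.trace_sq`). Tracing out `C` gives |N|⁻² 2⁻ⁿ f(H)²,
which is therefore normalized.

The running time is bounded by recursion on the program syntax, which yields a polynomial in n and
m. -/

namespace HDQI

/-! ### Programs as linear operators; step and oracle-call counts -/

section Semantics

variable {n m : ℕ}

/-- The action of a gate as a linear operator. -/
noncomputable def Gate.lin (g : Gate) (i : Option (Fin m)) (j : Option (Fin n)) :
    Module.End ℂ (StateVec (Qubit n m)) where
  toFun := g.apply i j
  map_add' ψ χ := by
    have hU : ∀ (U : Matrix (ZMod 2) (ZMod 2) ℂ) (q : Qubit n m),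
        onQubit U q (ψ + χ) = onQubit U q ψ + onQubit U q χ := fun U q => by
      funext x; simp [onQubit, mul_add, Finset.sum_add_distrib]
    cases g with
    | hadamard q => simp only [Gate.apply]; cases q.eval i j <;> simp [hU]
    | phaseFlip q => simp only [Gate.apply]; cases q.eval i j <;> simp [hU]
    | ctrl σ c t =>
      simp only [Gate.apply]
      cases c.eval i j <;> cases t.eval i j <;> simp only []
      split_ifs
      · rfl
      · funext x; simp only [onQubitCtrl, hU, Pi.add_apply]; split_ifs <;> rfl
  map_smul' a ψ := by
    have hU : ∀ (U : Matrix (ZMod 2) (ZMod 2) ℂ) (q : Qubit n m),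
        onQubit U q (a • ψ) = a • onQubit U q ψ := fun U q => by
      funext x; simp only [onQubit, Pi.smul_apply, smul_eq_mul, Finset.mul_sum]
      exact Finset.sum_congr rfl fun b _ => by ring
    cases g with
    | hadamard q => simp only [Gate.apply]; cases q.eval i j <;> simp [hU]
    | phaseFlip q => simp only [Gate.apply]; cases q.eval i j <;> simp [hU]
    | ctrl σ c t =>
      simp only [Gate.apply]
      cases c.eval i j <;> cases t.eval i j <;> simp only [RingHom.id_apply]
      split_ifs
      · rfl
      · funext x
        simp only [onQubitCtrl, hU, Pi.smul_apply]
        split_ifs <;> rfl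

/-- The linear operator that a program applies to the quantum state. -/
noncomputable def Prog.act (H : PauliHam n m)
    (D : Matrix (Bits (Qubit n m)) (Bits (Qubit n m)) ℂ) :
    Prog → Option (Fin m) → Option (Fin n) → Module.End ℂ (StateVec (Qubit n m))
  | .seq p q, i, j => q.act H D i j * p.act H D i j
  | .gate g, i, j => g.lin i j
  | .oracle, _, _ => D.mulVecLin
  | .forTerm p, _, j => ((List.finRange m).map fun i => p.act H D (some i) j).prod
  | .forSite p, i, _ => ((List.finRange n).map fun j => p.act H D i (some j)).prod
  | .ifNeg p, i, j =>
    match i with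
    | some i' => if H.v i' = -1 then p.act H D i j else 1
    | none => 1
  | .ifPauli σ p, i, j =>
    match i, j with
    | some i', some j' => if H.P i' j' = σ then p.act H D i j else 1
    | _, _ => 1

variable (H : PauliHam n m) (D : Matrix (Bits (Qubit n m)) (Bits (Qubit n m)) ℂ)

/-- Loops run downwards, so their reversed `foldl` is a `foldr`: the last index acts first, and the
operator product has its factors in increasing order. -/
theorem foldr_state {α : Type} (F : α → Machine n m → Machine n m)
    (L : α → Module.End ℂ (StateVec (Qubit n m))) (h : ∀ a M, (F a M).ψ = L a M.ψ)
    (l : List α) (M : Machine n m) :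
    (l.foldr F M).ψ = (l.map L).prod M.ψ := by
  induction l with
  | nil => rfl
  | cons a l ih => simp [h, ih]

theorem exec_state (p : Prog) (i : Option (Fin m)) (j : Option (Fin n)) (M : Machine n m) :
    (p.exec H D i j M).ψ = p.act H D i j M.ψ := by
  induction p generalizing i j M with
  | seq p q ihp ihq => simp [Prog.exec, Prog.act, ihp, ihq]
  | gate g => rfl
  | oracle => rfl
  | forTerm p ih =>
    simp only [Prog.exec, Prog.act, List.foldl_reverse]
    exact foldr_state _ (fun i => p.act H D (some i) j) (fun a M => ih _ _ M.tick) _ _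
  | forSite p ih =>
    simp only [Prog.exec, Prog.act, List.foldl_reverse]
    exact foldr_state _ (fun j => p.act H D i (some j)) (fun a M => ih _ _ M.tick) _ _
  | ifNeg p ih =>
    cases i with
    | none => rfl
    | some i => simp only [Prog.exec, Prog.act]; split_ifs <;> simp [ih, Machine.tick]
  | ifPauli σ p ih =>
    rcases i with _ | i <;> rcases j with _ | j <;> try rfl
    simp only [Prog.exec, Prog.act]; split_ifs <;> simp [ih, Machine.tick]

/-- An upper bound for the number of steps of a program. -/
def Prog.cost (n m : ℕ) : Prog → ℕ
  | .seq p q => p.cost n m + q.cost n m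
  | .gate _ => 1
  | .oracle => 1
  | .forTerm p => 1 + m * (1 + p.cost n m)
  | .forSite p => 1 + n * (1 + p.cost n m)
  | .ifNeg p => 1 + p.cost n m
  | .ifPauli _ p => 1 + p.cost n m

theorem foldr_time_le {α : Type} (F : α → Machine n m → Machine n m) (c : ℕ)
    (h : ∀ a M, (F a M).time ≤ M.time + c) (l : List α) (M : Machine n m) :
    (l.foldr F M).time ≤ M.time + l.length * c := by
  induction l with
  | nil => simp
  | cons a l ih =>
    simp only [List.foldr_cons, List.length_cons]
    have := h a (l.foldr F M)
    linarith

/-- Every test is charged as if its branch were taken, so the bound depends only on the syntax, n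
and m. -/
theorem exec_time_le (p : Prog) (i : Option (Fin m)) (j : Option (Fin n)) (M : Machine n m) :
    (p.exec H D i j M).time ≤ M.time + p.cost n m := by
  induction p generalizing i j M with
  | seq p q ihp ihq =>
    simp only [Prog.exec, Prog.cost]
    have h₁ := ihp i j M
    have h₂ := ihq i j (p.exec H D i j M)
    omega
  | gate g => rfl
  | oracle => rfl
  | forTerm p ih =>
    simp only [Prog.exec, Prog.cost, List.foldl_reverse]
    refine (foldr_time_le _ (1 + p.cost n m) (fun a M => ?_) _ _).trans ?_
    · refine (ih (some a) j M.tick).trans ?_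
      simp only [Machine.tick]; omega
    · simp only [Machine.tick, List.length_finRange]; omega
  | forSite p ih =>
    simp only [Prog.exec, Prog.cost, List.foldl_reverse]
    refine (foldr_time_le _ (1 + p.cost n m) (fun a M => ?_) _ _).trans ?_
    · refine (ih i (some a) M.tick).trans ?_
      simp only [Machine.tick]; omega
    · simp only [Machine.tick, List.length_finRange]; omega
  | ifNeg p ih =>
    simp only [Prog.cost]
    rcases i with _ | i
    · simp only [Prog.exec, Machine.tick]; omega
    · have := ih (some i) j M.tick
      simp only [Prog.exec]
      split_ifs <;> simp only [Machine.tick] at * <;> omega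
  | ifPauli σ p ih =>
    simp only [Prog.cost]
    rcases i with _ | i <;> rcases j with _ | j <;>
      try (simp only [Prog.exec, Machine.tick]; omega)
    have := ih (some i) (some j) M.tick
    simp only [Prog.exec]
    split_ifs <;> simp only [Machine.tick] at * <;> omega

/-- The program makes no oracle calls. -/
def Prog.OracleFree : Prog → Prop
  | .seq p q => p.OracleFree ∧ q.OracleFree
  | .gate _ => True
  | .oracle => False
  | .forTerm p => p.OracleFree
  | .forSite p => p.OracleFree
  | .ifNeg p => p.OracleFree
  | .ifPauli _ p => p.OracleFree

theorem foldr_calls {α : Type} (F : α → Machine n m → Machine n m)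
    (h : ∀ a M, (F a M).calls = M.calls) (l : List α) (M : Machine n m) :
    (l.foldr F M).calls = M.calls := by
  induction l with
  | nil => rfl
  | cons a l ih => simp [h, ih]

theorem Prog.OracleFree.exec_calls {p : Prog} (hp : p.OracleFree) (i : Option (Fin m))
    (j : Option (Fin n)) (M : Machine n m) : (p.exec H D i j M).calls = M.calls := by
  induction p generalizing i j M with
  | seq p q ihp ihq => simp [Prog.exec, ihp hp.1, ihq hp.2]
  | gate g => rfl
  | oracle => exact hp.elim
  | forTerm p ih =>
    simp only [Prog.exec, List.foldl_reverse]
    rw [foldr_calls _ fun a M => by rw [ih hp]; rfl]; rfl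
  | forSite p ih =>
    simp only [Prog.exec, List.foldl_reverse]
    rw [foldr_calls _ fun a M => by rw [ih hp]; rfl]; rfl
  | ifNeg p ih =>
    cases i with
    | none => rfl
    | some i => simp only [Prog.exec]; split_ifs <;> simp [ih hp, Machine.tick]
  | ifPauli σ p ih =>
    rcases i with _ | i <;> rcases j with _ | j <;> try rfl
    simp only [Prog.exec]; split_ifs <;> simp [ih hp, Machine.tick]

theorem hdqi_calls (ψ : StateVec (Qubit n m)) : (hdqi.run H D ψ).calls = 1 := by
  have h₁ : preparePhi.OracleFree := by simp [preparePhi, cnot, Prog.OracleFree]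
  have h₂ : applySigns.OracleFree := by simp [applySigns, Prog.OracleFree]
  have h₃ : controlledPaulis.OracleFree := by simp [controlledPaulis, Prog.OracleFree]
  have h₄ : bellMeasure.OracleFree := by simp [bellMeasure, swapBC, cnot, Prog.OracleFree]
  have h₅ : bellUnmeasure.OracleFree := by simp [bellUnmeasure, swapBC, cnot, Prog.OracleFree]
  simp only [Prog.run, hdqi, Prog.exec, h₁.exec_calls, h₂.exec_calls, h₃.exec_calls,
    h₄.exec_calls, h₅.exec_calls]

theorem hdqi_cost : hdqi.cost n m = 6 + 15 * n + 5 * m + 7 * (m * n) := by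
  simp only [hdqi, preparePhi, applySigns, controlledPaulis, bellMeasure, bellUnmeasure, swapBC,
    cnot, Prog.cost]
  ring

end Semantics

theorem hdqi_polynomial_time (a : Polynomial ℕ) : ∃ q : Polynomial ℕ,
    ∀ (n m : ℕ) (H : PauliHam n m) (D : Matrix (Bits (Qubit n m)) (Bits (Qubit n m)) ℂ)
      (ψ : StateVec (Qubit n m)),
      m ≤ a.eval n → (hdqi.run H D ψ).time ≤ q.eval n := by
  refine ⟨6 + 15 * Polynomial.X + 5 * a + 7 * (a * Polynomial.X), fun n m H D ψ hm => ?_⟩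
  refine (exec_time_le H D hdqi none none ⟨ψ, 0, 0⟩).trans ?_
  simp only [hdqi_cost, Polynomial.eval_add, Polynomial.eval_mul, Polynomial.eval_ofNat,
    Polynomial.eval_X]
  have : m * n ≤ a.eval n * n := Nat.mul_le_mul_right _ hm
  omega

/-! ### The circuit on states |y⟩ ⊗ (product over sites) -/

section ProductStates

variable {n m : ℕ}

/-- The state of registers `BC` that is a product over the sites, with amplitude matrix `φ j` at
site `j`. -/
def siteProd (φ : Fin n → Matrix (ZMod 2) (ZMod 2) ℂ) : StateVec (Fin n ⊕ Fin n) :=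
  fun s => ∏ j, φ j (s (Sum.inl j)) (s (Sum.inr j))

/-- The basis state `y` on `A`, and a product over the sites on `BC`. -/
def prodState (y : Bits (Fin m)) (φ : Fin n → Matrix (ZMod 2) (ZMod 2) ℂ) :
    StateVec (Qubit n m) :=
  tensorABC (ket y) (siteProd φ)

/-- The second factor does not involve the two qubits of site `j`, so a gate at that site changes
only `φ j`. -/
theorem prodState_apply (y : Bits (Fin m)) (φ : Fin n → Matrix (ZMod 2) (ZMod 2) ℂ)
    (j : Fin n) (x : Bits (Qubit n m)) :
    prodState y φ x = φ j (x (Sum.inr (Sum.inl j))) (x (Sum.inr (Sum.inr j))) *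
      (ket y (fun i => x (Sum.inl i)) * ∏ k ∈ Finset.univ.erase j,
        φ k (x (Sum.inr (Sum.inl k))) (x (Sum.inr (Sum.inr k)))) := by
  simp only [prodState, tensorABC, siteProd]
  rw [← Finset.mul_prod_erase _ _ (Finset.mem_univ j)]
  ring

theorem prodState_update (y : Bits (Fin m)) (φ : Fin n → Matrix (ZMod 2) (ZMod 2) ℂ)
    (j : Fin n) (A : Matrix (ZMod 2) (ZMod 2) ℂ) (x : Bits (Qubit n m)) :
    prodState y (Function.update φ j A) x =
      A (x (Sum.inr (Sum.inl j))) (x (Sum.inr (Sum.inr j))) *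
      (ket y (fun i => x (Sum.inl i)) * ∏ k ∈ Finset.univ.erase j,
        φ k (x (Sum.inr (Sum.inl k))) (x (Sum.inr (Sum.inr k)))) := by
  rw [prodState_apply y _ j, Function.update_self]
  congr 2
  refine Finset.prod_congr rfl fun k hk => ?_
  rw [Function.update_of_ne (Finset.ne_of_mem_erase hk)]

theorem prodState_update_bit_B (y : Bits (Fin m)) (φ : Fin n → Matrix (ZMod 2) (ZMod 2) ℂ)
    (j : Fin n) (x : Bits (Qubit n m)) (b : ZMod 2) :
    prodState y φ (Function.update x (Sum.inr (Sum.inl j)) b) =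
      φ j b (x (Sum.inr (Sum.inr j))) *
      (ket y (fun i => x (Sum.inl i)) * ∏ k ∈ Finset.univ.erase j,
        φ k (x (Sum.inr (Sum.inl k))) (x (Sum.inr (Sum.inr k)))) := by
  rw [prodState_apply y _ j, Function.update_self, Function.update_of_ne (by simp)]
  congr 2
  refine Finset.prod_congr rfl fun k hk => ?_
  rw [Function.update_of_ne (by simpa using Finset.ne_of_mem_erase hk),
    Function.update_of_ne (by simp)]

theorem prodState_update_bit_C (y : Bits (Fin m)) (φ : Fin n → Matrix (ZMod 2) (ZMod 2) ℂ)
    (j : Fin n) (x : Bits (Qubit n m)) (b : ZMod 2) :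
    prodState y φ (Function.update x (Sum.inr (Sum.inr j)) b) =
      φ j (x (Sum.inr (Sum.inl j))) b *
      (ket y (fun i => x (Sum.inl i)) * ∏ k ∈ Finset.univ.erase j,
        φ k (x (Sum.inr (Sum.inl k))) (x (Sum.inr (Sum.inr k)))) := by
  rw [prodState_apply y _ j, Function.update_self, Function.update_of_ne (by simp)]
  congr 2
  refine Finset.prod_congr rfl fun k hk => ?_
  rw [Function.update_of_ne (by simp),
    Function.update_of_ne (by simpa using Finset.ne_of_mem_erase hk)]

/-- Rows of an amplitude matrix are indexed by the `B` bit and columns by the `C` bit: gates on `B`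
multiply from the left, gates on `C` from the right by the transpose. -/
theorem onQubit_B (U : Matrix (ZMod 2) (ZMod 2) ℂ) (y : Bits (Fin m))
    (φ : Fin n → Matrix (ZMod 2) (ZMod 2) ℂ) (j : Fin n) :
    onQubit U (Sum.inr (Sum.inl j)) (prodState y φ) =
      prodState y (Function.update φ j (U * φ j)) := by
  funext x
  simp only [onQubit, prodState_update_bit_B, prodState_update, Matrix.mul_apply, Finset.sum_mul]
  exact Finset.sum_congr rfl fun b _ => by ring

theorem onQubit_C (U : Matrix (ZMod 2) (ZMod 2) ℂ) (y : Bits (Fin m))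
    (φ : Fin n → Matrix (ZMod 2) (ZMod 2) ℂ) (j : Fin n) :
    onQubit U (Sum.inr (Sum.inr j)) (prodState y φ) =
      prodState y (Function.update φ j (φ j * Uᵀ)) := by
  funext x
  simp only [onQubit, prodState_update_bit_C, prodState_update, Matrix.mul_apply, Finset.sum_mul,
    Matrix.transpose_apply]
  exact Finset.sum_congr rfl fun b _ => by ring

theorem onQubitCtrl_AB (U : Matrix (ZMod 2) (ZMod 2) ℂ) (y : Bits (Fin m))
    (φ : Fin n → Matrix (ZMod 2) (ZMod 2) ℂ) (i : Fin m) (j : Fin n) :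
    onQubitCtrl U (Sum.inl i) (Sum.inr (Sum.inl j)) (prodState y φ) =
      prodState y (Function.update φ j (if y i = 1 then U * φ j else φ j)) := by
  funext x
  simp only [onQubitCtrl, onQubit_B]
  by_cases hx : (fun i => x (Sum.inl i)) = y
  · subst hx
    split_ifs <;> simp
  -- Off the support of |y⟩ both sides vanish; on it the control bit is the classical value `y i`.
  · have h : ∀ φ' : Fin n → Matrix (ZMod 2) (ZMod 2) ℂ, prodState y φ' x = 0 := fun φ' => by
      simp [prodState, tensorABC, ket, hx]
    simp [h]

theorem zmod_two_cases : ∀ a : ZMod 2, a = 0 ∨ a = 1 := by decide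

theorem zmod_two_eq_zero_of_ne_one {b : ZMod 2} (h : ¬ b = 1) : b = 0 :=
  (zmod_two_cases b).resolve_right h

theorem sum_zmod_two {R : Type*} [AddCommMonoid R] (F : ZMod 2 → R) : ∑ c, F c = F 0 + F 1 :=
  Fin.sum_univ_two F

/-- The controlled-NOT with control `B` and target `C` on the amplitudes of one site. -/
def cnotBC (A : Matrix (ZMod 2) (ZMod 2) ℂ) : Matrix (ZMod 2) (ZMod 2) ℂ :=
  Matrix.of fun b c => A b (c + b)

/-- The controlled-NOT with control `C` and target `B` on the amplitudes of one site. -/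
def cnotCB (A : Matrix (ZMod 2) (ZMod 2) ℂ) : Matrix (ZMod 2) (ZMod 2) ℂ :=
  Matrix.of fun b c => A (b + c) c

theorem pauliX_mul_apply (A : Matrix (ZMod 2) (ZMod 2) ℂ) (b c : ZMod 2) :
    (Pauli.X.mat * A) b c = A (b + 1) c := by
  rcases zmod_two_cases b with rfl | rfl <;>
    simp [Matrix.mul_apply, Pauli.mat, sum_zmod_two, show (1 : ZMod 2) + 1 = 0 from rfl]

theorem mul_pauliX_transpose_apply (A : Matrix (ZMod 2) (ZMod 2) ℂ) (b c : ZMod 2) :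
    (A * Pauli.X.matᵀ) b c = A b (c + 1) := by
  rcases zmod_two_cases c with rfl | rfl <;>
    simp [Matrix.mul_apply, Pauli.mat, sum_zmod_two, show (1 : ZMod 2) + 1 = 0 from rfl]

theorem onQubitCtrl_BC (y : Bits (Fin m)) (φ : Fin n → Matrix (ZMod 2) (ZMod 2) ℂ) (j : Fin n) :
    onQubitCtrl Pauli.X.mat (Sum.inr (Sum.inl j)) (Sum.inr (Sum.inr j)) (prodState y φ) =
      prodState y (Function.update φ j (cnotBC (φ j))) := by
  funext x
  simp only [onQubitCtrl, onQubit_C]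
  split_ifs with h
  · rw [prodState_update, prodState_update, mul_pauliX_transpose_apply]
    simp [cnotBC, h]
  · rw [prodState_update, prodState_apply y _ j]
    simp [cnotBC, zmod_two_eq_zero_of_ne_one h]

theorem onQubitCtrl_CB (y : Bits (Fin m)) (φ : Fin n → Matrix (ZMod 2) (ZMod 2) ℂ) (j : Fin n) :
    onQubitCtrl Pauli.X.mat (Sum.inr (Sum.inr j)) (Sum.inr (Sum.inl j)) (prodState y φ) =
      prodState y (Function.update φ j (cnotCB (φ j))) := by
  funext x
  simp only [onQubitCtrl, onQubit_B]
  split_ifs with h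
  · rw [prodState_update, prodState_update, pauliX_mul_apply]
    simp [cnotCB, h]
  · rw [prodState_update, prodState_apply y _ j]
    simp [cnotCB, zmod_two_eq_zero_of_ne_one h]

/-- Three alternating shears of 𝔽₂² compose to the exchange of coordinates. -/
theorem cnot_swap (A : Matrix (ZMod 2) (ZMod 2) ℂ) : cnotBC (cnotCB (cnotBC A)) = Aᵀ := by
  ext b c
  simp only [cnotBC, cnotCB, Matrix.of_apply, Matrix.transpose_apply]
  congr 1 <;> (revert b c; decide)

variable (H : PauliHam n m) (D : Matrix (Bits (Qubit n m)) (Bits (Qubit n m)) ℂ)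

theorem act_cnotBC (y : Bits (Fin m)) (φ : Fin n → Matrix (ZMod 2) (ZMod 2) ℂ)
    (i : Option (Fin m)) (j : Fin n) :
    (cnot .B .C).act H D i (some j) (prodState y φ) =
      prodState y (Function.update φ j (cnotBC (φ j))) := by
  simp [cnot, Prog.act, Gate.lin, Gate.apply, Ref.eval, onQubitCtrl_BC]

theorem act_cnotCB (y : Bits (Fin m)) (φ : Fin n → Matrix (ZMod 2) (ZMod 2) ℂ)
    (i : Option (Fin m)) (j : Fin n) :
    (cnot .C .B).act H D i (some j) (prodState y φ) =
      prodState y (Function.update φ j (cnotCB (φ j))) := by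
  simp [cnot, Prog.act, Gate.lin, Gate.apply, Ref.eval, onQubitCtrl_CB]

theorem act_swapBC (y : Bits (Fin m)) (φ : Fin n → Matrix (ZMod 2) (ZMod 2) ℂ)
    (i : Option (Fin m)) (j : Fin n) :
    swapBC.act H D i (some j) (prodState y φ) =
      prodState y (Function.update φ j (φ j)ᵀ) := by
  simp [swapBC, Prog.act, act_cnotBC, act_cnotCB, cnot_swap]

theorem act_hadamard_B (y : Bits (Fin m)) (φ : Fin n → Matrix (ZMod 2) (ZMod 2) ℂ)
    (i : Option (Fin m)) (j : Fin n) :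
    (Prog.gate (.hadamard .B)).act H D i (some j) (prodState y φ) =
      prodState y (Function.update φ j (hadamardMat * φ j)) := by
  simp [Prog.act, Gate.lin, Gate.apply, Ref.eval, onQubit_B]

/-- Iterations at different sites touch different factors. The induction runs over duplicate-free
lists, so each site is updated once, from its original value. -/
theorem act_forSite {p : Prog} {i j₀} {y : Bits (Fin m)}
    (g : Fin n → Matrix (ZMod 2) (ZMod 2) ℂ → Matrix (ZMod 2) (ZMod 2) ℂ)
    (h : ∀ j φ, p.act H D i (some j) (prodState y φ) =
      prodState y (Function.update φ j (g j (φ j))))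
    (φ : Fin n → Matrix (ZMod 2) (ZMod 2) ℂ) :
    (Prog.forSite p).act H D i j₀ (prodState y φ) = prodState y fun j => g j (φ j) := by
  have key : ∀ l : List (Fin n), l.Nodup →
      (l.map fun j => p.act H D i (some j)).prod (prodState y φ) =
        prodState y fun j => if j ∈ l then g j (φ j) else φ j := by
    intro l hl
    induction l with
    | nil => simp
    | cons a l ih =>
      rw [List.nodup_cons] at hl
      rw [List.map_cons, List.prod_cons, Module.End.mul_apply, ih hl.2, h]
      congr 1
      funext j
      rcases eq_or_ne j a with rfl | hj
      · simp [hl.1]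
      · simp [hj]
  simp only [Prog.act]
  rw [key _ (List.nodup_finRange n)]
  simp

/-- The amplitudes of the basis state `x, z` of one site. -/
def siteKet (x z : ZMod 2) : Matrix (ZMod 2) (ZMod 2) ℂ :=
  Matrix.of fun b c => if b = x ∧ c = z then 1 else 0

/-- The amplitudes of one maximally entangled pair. -/
noncomputable def sitePhi : Matrix (ZMod 2) (ZMod 2) ℂ := ((Real.sqrt 2 : ℝ) : ℂ)⁻¹ • 1

theorem siteProd_siteKet (s : Bits (Fin n ⊕ Fin n)) :
    siteProd (fun j => siteKet (s (Sum.inl j)) (s (Sum.inr j))) = ket s := by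
  funext t
  simp only [siteProd, siteKet, Matrix.of_apply, ket, Pi.single_apply]
  rw [Finset.prod_ite_zero]
  simp only [Finset.prod_const_one]
  refine if_congr ⟨fun h => ?_, fun h => by simp [h]⟩ rfl rfl
  funext r
  rcases r with j | j
  · exact (h j (Finset.mem_univ _)).1
  · exact (h j (Finset.mem_univ _)).2

theorem siteProd_sitePhi : siteProd (fun _ : Fin n => sitePhi) = maxEntangled n := by
  funext t
  simp only [siteProd, sitePhi, maxEntangled, Matrix.smul_apply, Matrix.one_apply, smul_eq_mul,
    mul_ite, mul_one, mul_zero]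
  rw [Finset.prod_ite_zero]
  simp only [Finset.prod_const, Finset.card_univ, Fintype.card_fin, funext_iff, Finset.mem_univ,
    true_imp_iff]
  refine if_congr Iff.rfl ?_ rfl
  push_cast
  rw [inv_pow]

theorem siteProd_smul (c : Fin n → ℂ) (φ : Fin n → Matrix (ZMod 2) (ZMod 2) ℂ) :
    siteProd (fun j => c j • φ j) = (∏ j, c j) • siteProd φ := by
  funext t
  simp [siteProd, Finset.prod_mul_distrib]

/-- The coherent Bell measurement on the amplitudes of one site. -/
noncomputable def siteBell (A : Matrix (ZMod 2) (ZMod 2) ℂ) : Matrix (ZMod 2) (ZMod 2) ℂ :=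
  (hadamardMat * cnotBC A)ᵀ

theorem inv_sqrt_two_mul_self :
    ((Real.sqrt 2 : ℝ) : ℂ)⁻¹ * ((Real.sqrt 2 : ℝ) : ℂ)⁻¹ = 1 / 2 := by
  rw [← mul_inv, ← Complex.ofReal_mul, Real.mul_self_sqrt (by norm_num)]
  norm_num

theorem hadamardMat_mul_self : hadamardMat * hadamardMat = 1 := by
  ext a b
  have e : ∀ a b, hadamardMat a b = ((Real.sqrt 2 : ℝ) : ℂ)⁻¹ * if a = 1 ∧ b = 1 then -1 else 1 :=
    fun a b => rfl
  rw [Matrix.mul_apply, sum_zmod_two, e, e, e, e]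
  have key : ∀ (s t u v : ℂ), ((Real.sqrt 2 : ℝ) : ℂ)⁻¹ * s * (((Real.sqrt 2 : ℝ) : ℂ)⁻¹ * t) +
      ((Real.sqrt 2 : ℝ) : ℂ)⁻¹ * u * (((Real.sqrt 2 : ℝ) : ℂ)⁻¹ * v) = (s * t + u * v) / 2 := by
    intro s t u v
    linear_combination (s * t + u * v) * inv_sqrt_two_mul_self
  rw [key, Matrix.one_apply]
  rcases zmod_two_cases a with rfl | rfl <;>
    rcases zmod_two_cases b with rfl | rfl <;> norm_num

theorem cnotBC_cnotBC (A : Matrix (ZMod 2) (ZMod 2) ℂ) : cnotBC (cnotBC A) = A := by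
  ext b c
  simp only [cnotBC, Matrix.of_apply]
  congr 1; revert b c; decide

theorem siteBell_inverse (A : Matrix (ZMod 2) (ZMod 2) ℂ) :
    cnotBC (hadamardMat * (siteBell A)ᵀ) = A := by
  rw [siteBell, Matrix.transpose_transpose, ← Matrix.mul_assoc, hadamardMat_mul_self,
    Matrix.one_mul, cnotBC_cnotBC]

theorem act_bellMeasure (y : Bits (Fin m)) (φ : Fin n → Matrix (ZMod 2) (ZMod 2) ℂ) :
    bellMeasure.act H D none none (prodState y φ) = prodState y fun j => siteBell (φ j) := by
  refine act_forSite H D (fun _ => siteBell) (fun j φ => ?_) φ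
  simp only [Prog.act.eq_1, Module.End.mul_apply, act_cnotBC, act_hadamard_B, act_swapBC]
  simp [siteBell]

theorem act_bellUnmeasure (y : Bits (Fin m)) (φ : Fin n → Matrix (ZMod 2) (ZMod 2) ℂ) :
    bellUnmeasure.act H D none none (prodState y fun j => siteBell (φ j)) = prodState y φ := by
  have := act_forSite H D (p := .seq swapBC (.seq (.gate (.hadamard .B)) (cnot .B .C)))
    (i := none) (j₀ := none) (y := y)
    (fun _ A => cnotBC (hadamardMat * Aᵀ)) (fun j φ => ?_) (fun j => siteBell (φ j))
  · simp only [siteBell_inverse] at this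
    exact this
  · simp only [Prog.act.eq_1, Module.End.mul_apply, act_cnotBC, act_hadamard_B, act_swapBC]
    simp

theorem cnotBC_hadamard_siteKet : cnotBC (hadamardMat * siteKet 0 0) = sitePhi := by
  ext a b
  simp only [cnotBC, siteKet, hadamardMat, sitePhi, Matrix.of_apply, Matrix.mul_apply,
    Matrix.smul_apply, Matrix.one_apply, smul_eq_mul]
  rw [sum_zmod_two]
  rcases zmod_two_cases a with rfl | rfl <;>
    rcases zmod_two_cases b with rfl | rfl <;>
    simp [show (1 : ZMod 2) + 1 = 0 from rfl]

theorem act_preparePhi (y : Bits (Fin m)) :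
    preparePhi.act H D none none (tensorABC (ket y) (ket 0)) =
      prodState y (fun _ : Fin n => sitePhi) := by
  have := act_forSite H D (p := .seq (.gate (.hadamard .B)) (cnot .B .C))
    (i := none) (j₀ := none) (y := y) (fun _ A => cnotBC (hadamardMat * A)) (fun j φ => ?_)
    (fun _ => siteKet 0 0)
  · rw [cnotBC_hadamard_siteKet] at this
    rw [← this, ← siteProd_siteKet]
    rfl
  · simp only [Prog.act.eq_1, Module.End.mul_apply, act_cnotBC, act_hadamard_B]
    simp

/-- The sign `∏ i, v i ^ y i` over the terms of a list. -/
def signProd (y : Bits (Fin m)) (l : List (Fin m)) : ℂ :=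
  (l.map fun i => if y i = 1 then ((H.v i : ℤ) : ℂ) else 1).prod

theorem onQubit_A_phaseFlip (y : Bits (Fin m)) (χ : StateVec (Fin n ⊕ Fin n)) (i : Fin m) :
    onQubit Pauli.Z.mat (Sum.inl i) (tensorABC (ket y) χ) =
      (if y i = 1 then (-1 : ℂ) else 1) • tensorABC (ket y) χ := by
  funext x
  have hz : ∀ b, Pauli.Z.mat (x (Sum.inl i)) b = if b = x (Sum.inl i) then
      (if x (Sum.inl i) = 1 then (-1 : ℂ) else 1) else 0 := fun b => by
    rcases zmod_two_cases b with rfl | rfl <;> rcases zmod_two_cases (x (Sum.inl i)) with h | h <;>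
      simp [Pauli.mat, h]
  simp only [onQubit, hz, ite_mul, zero_mul, Finset.sum_ite_eq', Finset.mem_univ, if_true,
    Function.update_eq_self, Pi.smul_apply, smul_eq_mul]
  by_cases hx : (fun i => x (Sum.inl i)) = y
  · subst hx; simp
  · simp [tensorABC, ket, hx]

theorem act_applySigns (y : Bits (Fin m)) (χ : StateVec (Fin n ⊕ Fin n)) :
    applySigns.act H D none none (tensorABC (ket y) χ) =
      signProd H y (List.finRange m) • tensorABC (ket y) χ := by
  simp only [applySigns, Prog.act]
  induction List.finRange m with
  | nil => simp [signProd]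
  | cons a l ih =>
    rw [List.map_cons, List.prod_cons, Module.End.mul_apply, ih, map_smul]
    rw [show signProd H y (a :: l) =
      (if y a = 1 then ((H.v a : ℤ) : ℂ) else 1) * signProd H y l by simp [signProd]]
    rw [mul_comm, mul_smul]
    congr 1
    rcases Int.units_eq_one_or (H.v a) with h | h
    · simp [h]
    · simp [h, Gate.lin, Gate.apply, Ref.eval, onQubit_A_phaseFlip]

/-- The factors at site `j` of the ordered product of the Paulis selected by `y`. -/
noncomputable def siteFactor (y : Bits (Fin m)) (l : List (Fin m)) (j : Fin n) :
    Matrix (ZMod 2) (ZMod 2) ℂ :=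
  (l.map fun i => if y i = 1 then (H.P i j).mat else 1).prod

theorem pauliI_mat : Pauli.I.mat = 1 := by
  ext a b; simp [Pauli.mat, Matrix.one_apply]

theorem act_controlledPaulis (y : Bits (Fin m)) (φ : Fin n → Matrix (ZMod 2) (ZMod 2) ℂ) :
    controlledPaulis.act H D none none (prodState y φ) =
      prodState y fun j => siteFactor H y (List.finRange m) j * φ j := by
  unfold controlledPaulis
  rw [Prog.act]
  induction List.finRange m with
  | nil => simp [siteFactor]
  | cons a l ih =>
    rw [List.map_cons, List.prod_cons, Module.End.mul_apply, ih]
    rw [act_forSite H D (fun j A => (if y a = 1 then (H.P a j).mat else 1) * A)]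
    · simp [siteFactor, Matrix.mul_assoc]
    · intro j φ
      -- When `P a` is `I` at site `j` no test fires, in agreement with the factor `Pauli.I.mat =
      -- 1`.
      rcases h : H.P a j <;>
        simp only [Prog.act, h, Module.End.mul_apply, reduceCtorEq, if_true, if_false, Gate.lin,
          Gate.apply, Ref.eval, Option.map_some, LinearMap.coe_mk, AddHom.coe_mk,
          Module.End.one_apply, onQubitCtrl_AB] <;>
        split_ifs <;> simp [pauliI_mat]

end ProductStates

/-! ### Tensor products of one-site matrices -/

section TensorProducts

variable {n m : ℕ}

/-- The tensor product of one matrix per site. -/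
def tensorMat (A : Fin n → Matrix (ZMod 2) (ZMod 2) ℂ) :
    Matrix (Bits (Fin n)) (Bits (Fin n)) ℂ :=
  Matrix.of fun x y => ∏ j, A j (x j) (y j)

theorem tensorMat_mul (A B : Fin n → Matrix (ZMod 2) (ZMod 2) ℂ) :
    tensorMat A * tensorMat B = tensorMat fun j => A j * B j := by
  ext x y
  simp only [tensorMat, Matrix.mul_apply, Matrix.of_apply, ← Finset.prod_mul_distrib]
  rw [Finset.prod_univ_sum]
  simp [Fintype.piFinset_univ]

theorem tensorMat_one : tensorMat (fun _ : Fin n => 1) = 1 := by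
  ext x y
  simp only [tensorMat, Matrix.of_apply, Matrix.one_apply]
  rw [Finset.prod_ite_zero]
  simp [funext_iff]

theorem tensorMat_smul (c : Fin n → ℂ) (A : Fin n → Matrix (ZMod 2) (ZMod 2) ℂ) :
    tensorMat (fun j => c j • A j) = (∏ j, c j) • tensorMat A := by
  ext x y
  simp [tensorMat, Finset.prod_mul_distrib]

theorem tensorMat_conjTranspose (A : Fin n → Matrix (ZMod 2) (ZMod 2) ℂ) :
    (tensorMat A)ᴴ = tensorMat fun j => (A j)ᴴ := by
  ext x y
  simp [tensorMat, Matrix.conjTranspose_apply]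

theorem tensorMat_trace (A : Fin n → Matrix (ZMod 2) (ZMod 2) ℂ) :
    (tensorMat A).trace = ∏ j, (A j).trace := by
  simp only [tensorMat, Matrix.trace, Matrix.diag, Matrix.of_apply]
  rw [Finset.prod_univ_sum]
  simp [Fintype.piFinset_univ]

theorem applyB_tensorMat_siteProd (A φ : Fin n → Matrix (ZMod 2) (ZMod 2) ℂ) :
    applyB (tensorMat A) (siteProd φ) = siteProd fun j => A j * φ j := by
  funext s
  simp only [applyB, tensorMat, siteProd, Matrix.mul_apply, Matrix.of_apply, Sum.elim_inl,
    Sum.elim_inr, ← Finset.prod_mul_distrib]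
  rw [Finset.prod_univ_sum]
  simp [Fintype.piFinset_univ]

theorem applyB_smul (c : ℂ) (M : Matrix (Bits (Fin n)) (Bits (Fin n)) ℂ)
    (ψ : StateVec (Fin n ⊕ Fin n)) : applyB (c • M) ψ = c • applyB M ψ := by
  funext s
  simp [applyB, Finset.mul_sum, mul_assoc]

theorem applyB_sum {ι : Type*} (t : Finset ι) (M : ι → Matrix (Bits (Fin n)) (Bits (Fin n)) ℂ)
    (ψ : StateVec (Fin n ⊕ Fin n)) : applyB (∑ i ∈ t, M i) ψ = ∑ i ∈ t, applyB (M i) ψ := by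
  funext s
  simp only [applyB, Matrix.sum_apply, Finset.sum_apply, Finset.sum_mul]
  exact Finset.sum_comm

end TensorProducts

/-! ### Pauli phases, syndromes and trace orthogonality -/

section PauliAlgebra

/-- The matrix `X ^ x * Z ^ z`. -/
def bellMat (x z : ZMod 2) : Matrix (ZMod 2) (ZMod 2) ℂ :=
  Matrix.of fun a b => if a = b + x then (if z = 1 ∧ b = 1 then -1 else 1) else 0

theorem bellMat_zero : bellMat 0 0 = 1 := by
  ext a b; simp [bellMat, Matrix.one_apply]

/-- The sign comes from moving Z^z past X^x'. -/
theorem bellMat_mul (x z x' z' : ZMod 2) :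
    bellMat x z * bellMat x' z' =
      (if z = 1 ∧ x' = 1 then (-1 : ℂ) else 1) • bellMat (x + x') (z + z') := by
  have h11 : (1 : ZMod 2) + 1 = 0 := rfl
  ext a b
  simp only [Matrix.mul_apply, sum_zmod_two, Matrix.smul_apply, smul_eq_mul, bellMat,
    Matrix.of_apply]
  rcases zmod_two_cases x with rfl | rfl <;> rcases zmod_two_cases z with rfl | rfl <;>
    rcases zmod_two_cases x' with rfl | rfl <;> rcases zmod_two_cases z' with rfl | rfl <;>
    rcases zmod_two_cases a with rfl | rfl <;> rcases zmod_two_cases b with rfl | rfl <;>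
    simp [h11]

theorem Pauli.mat_eq_smul_bellMat (σ : Pauli) :
    ∃ c : ℂ, c * star c = 1 ∧ σ.mat = c • bellMat σ.xBit σ.zBit := by
  have h11 : (1 : ZMod 2) + 1 = 0 := rfl
  cases σ
  case Y =>
    -- Y = i X Z.
    refine ⟨Complex.I, by simp, ?_⟩
    ext a b
    rcases zmod_two_cases a with rfl | rfl <;> rcases zmod_two_cases b with rfl | rfl <;>
      simp [Pauli.mat, bellMat, Pauli.xBit, Pauli.zBit, h11]
  all_goals
    refine ⟨1, by simp, ?_⟩
    ext a b
    rcases zmod_two_cases a with rfl | rfl <;> rcases zmod_two_cases b with rfl | rfl <;>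
      simp [Pauli.mat, bellMat, Pauli.xBit, Pauli.zBit, h11]

theorem Pauli.mat_mul_self (σ : Pauli) : σ.mat * σ.mat = 1 := by
  ext a b
  cases σ <;> simp only [Matrix.mul_apply, sum_zmod_two, Pauli.mat, Matrix.of_apply] <;>
    rcases zmod_two_cases a with rfl | rfl <;> rcases zmod_two_cases b with rfl | rfl <;>
      simp

theorem Pauli.mat_conjTranspose (σ : Pauli) : σ.matᴴ = σ.mat := by
  ext a b
  cases σ <;> simp only [Matrix.conjTranspose_apply, Pauli.mat, Matrix.of_apply] <;>
    rcases zmod_two_cases a with rfl | rfl <;> rcases zmod_two_cases b with rfl | rfl <;>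
      simp

theorem Pauli.mat_mul_comm_or (σ τ : Pauli) :
    ∃ s : ℂ, (s = 1 ∨ s = -1) ∧ σ.mat * τ.mat = s • (τ.mat * σ.mat) := by
  obtain ⟨c, -, hc⟩ := σ.mat_eq_smul_bellMat
  obtain ⟨d, -, hd⟩ := τ.mat_eq_smul_bellMat
  -- The sign is (-1) to the symplectic form of the two Paulis, one factor per order of
  -- multiplication.
  refine ⟨(if σ.zBit = 1 ∧ τ.xBit = 1 then (-1 : ℂ) else 1) *
    (if τ.zBit = 1 ∧ σ.xBit = 1 then (-1 : ℂ) else 1), ?_, ?_⟩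
  · split_ifs <;> simp
  · rw [hc, hd, Matrix.smul_mul, Matrix.mul_smul, bellMat_mul, Matrix.smul_mul, Matrix.mul_smul,
      bellMat_mul, add_comm τ.xBit, add_comm τ.zBit]
    simp only [smul_smul]
    congr 1
    split_ifs <;> ring

theorem siteBell_bellMat (x z : ZMod 2) :
    siteBell (bellMat x z * sitePhi) =
      (if x = 1 ∧ z = 1 then (-1 : ℂ) else 1) • siteKet x z := by
  have h11 : (1 : ZMod 2) + 1 = 0 := rfl
  have h3 := inv_sqrt_two_mul_self
  ext a b
  simp only [siteBell, sitePhi, cnotBC, hadamardMat, Matrix.one_apply,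
    Matrix.transpose_apply, Matrix.mul_apply, sum_zmod_two, Matrix.of_apply, Matrix.smul_apply,
    smul_eq_mul, bellMat, siteKet]
  -- From here on only r² = 1/2 matters.
  generalize ((Real.sqrt 2 : ℝ) : ℂ)⁻¹ = r at h3
  rcases zmod_two_cases x with rfl | rfl <;> rcases zmod_two_cases z with rfl | rfl <;>
    rcases zmod_two_cases a with rfl | rfl <;> rcases zmod_two_cases b with rfl | rfl <;>
    simp [h11] <;> first | linear_combination 2 * h3 | linear_combination -2 * h3

theorem bellMat_trace_mul_self (x z : ZMod 2) : (bellMat x z * (bellMat x z)ᴴ).trace = 2 := by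
  have h11 : (1 : ZMod 2) + 1 = 0 := rfl
  simp only [Matrix.trace, Matrix.diag, Matrix.mul_apply, sum_zmod_two, bellMat,
    Matrix.conjTranspose_apply, Matrix.of_apply]
  rcases zmod_two_cases x with rfl | rfl <;> rcases zmod_two_cases z with rfl | rfl <;>
    simp [h11] <;> norm_num

/-- The product is, up to sign, a non-identity X^a Z^b, which is traceless. -/
theorem bellMat_trace_mul_of_ne (x z x' z' : ZMod 2) (h : x ≠ x' ∨ z ≠ z') :
    (bellMat x z * (bellMat x' z')ᴴ).trace = 0 := by
  have h11 : (1 : ZMod 2) + 1 = 0 := rfl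
  simp only [Matrix.trace, Matrix.diag, Matrix.mul_apply, sum_zmod_two, bellMat,
    Matrix.conjTranspose_apply, Matrix.of_apply]
  rcases zmod_two_cases x with rfl | rfl <;> rcases zmod_two_cases z with rfl | rfl <;>
    rcases zmod_two_cases x' with rfl | rfl <;> rcases zmod_two_cases z' with rfl | rfl <;>
    simp_all

variable {n m : ℕ} (H : PauliHam n m)

theorem pauliOp_eq_tensorMat (P : Fin n → Pauli) : pauliOp P = tensorMat fun j => (P j).mat :=
  rfl

theorem pauliOp_mul_self (P : Fin n → Pauli) : pauliOp P * pauliOp P = 1 := by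
  simp [pauliOp_eq_tensorMat, tensorMat_mul, Pauli.mat_mul_self, tensorMat_one]

theorem PauliHam.term_mul_self (i : Fin m) : H.term i * H.term i = 1 := by
  rcases Int.units_eq_one_or (H.v i) with h | h <;>
    simp [PauliHam.term, h, pauliOp_mul_self]

theorem PauliHam.term_conjTranspose (i : Fin m) : (H.term i)ᴴ = H.term i := by
  simp [PauliHam.term, pauliOp_eq_tensorMat, tensorMat_conjTranspose, Pauli.mat_conjTranspose]

theorem PauliHam.poly_conjTranspose (f : Polynomial ℝ) : (H.poly f)ᴴ = H.poly f := by
  have hop : H.opᴴ = H.op := by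
    simp [PauliHam.op, Matrix.conjTranspose_sum, PauliHam.term_conjTranspose]
  simp only [PauliHam.poly, Polynomial.aeval_eq_sum_range, Matrix.conjTranspose_sum,
    Matrix.conjTranspose_smul, Matrix.conjTranspose_pow, hop, star_trivial]

theorem pauliOp_mul_comm_or (P Q : Fin n → Pauli) :
    pauliOp P * pauliOp Q = pauliOp Q * pauliOp P ∨
      pauliOp P * pauliOp Q = -(pauliOp Q * pauliOp P) := by
  choose s hs hmul using fun j => Pauli.mat_mul_comm_or (P j) (Q j)
  have h : pauliOp P * pauliOp Q = (∏ j, s j) • (pauliOp Q * pauliOp P) := by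
    simp only [pauliOp_eq_tensorMat, tensorMat_mul, hmul, tensorMat_smul]
  have hprod : ∏ j, s j = 1 ∨ ∏ j, s j = -1 :=
    Finset.prod_induction s (fun c => c = 1 ∨ c = -1)
      (by rintro a b (rfl | rfl) (rfl | rfl) <;> simp) (Or.inl rfl) fun j _ => hs j
  rcases hprod with h1 | h1
  · left; rw [h, h1, one_smul]
  · right; rw [h, h1, neg_one_smul]

-- Paulis either commute or anticommute, so non-adjacent distinct terms commute. The case `i = j` is
-- excluded because the graph has no loops.
open Classical in
theorem PauliHam.term_mul_comm {i j : Fin m} (hij : i ≠ j) :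
    H.term i * H.term j =
      (if H.antiGraph.Adj i j then (-1 : ℝ) else 1) • (H.term j * H.term i) := by
  split_ifs with h
  · rw [neg_one_smul]; exact h.2
  · rw [one_smul]
    have : H.term i * H.term j = H.term j * H.term i ∨
        H.term i * H.term j = -(H.term j * H.term i) := by
      simp only [PauliHam.term, Matrix.smul_mul, Matrix.mul_smul]
      rcases pauliOp_mul_comm_or (H.P i) (H.P j) with h | h
      · left; rw [h, smul_comm]
      · right; rw [h, smul_comm]; simp
    exact this.resolve_right fun h' => h ⟨hij, h'⟩

/-- The ordered product of the terms in a list that are selected by `y`. -/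
noncomputable def termProd (y : Bits (Fin m)) (l : List (Fin m)) :
    Matrix (Bits (Fin n)) (Bits (Fin n)) ℂ :=
  (l.map fun i => if y i = 1 then H.term i else 1).prod

theorem termProd_eq_tensorMat (y : Bits (Fin m)) (l : List (Fin m)) :
    termProd H y l = signProd H y l • tensorMat (siteFactor H y l) := by
  induction l with
  | nil =>
    simp only [termProd, signProd, List.map_nil, List.prod_nil, one_smul]
    exact tensorMat_one.symm
  | cons a l ih =>
    have h₁ : termProd H y (a :: l) = (if y a = 1 then H.term a else 1) * termProd H y l := by
      simp [termProd]
    have h₂ : signProd H y (a :: l) =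
      (if y a = 1 then ((H.v a : ℤ) : ℂ) else 1) * signProd H y l := by simp [signProd]
    have h₃ : siteFactor H y (a :: l) = fun j =>
      (if y a = 1 then (H.P a j).mat else 1) * siteFactor H y l j := by
      funext j; simp [siteFactor]
    rw [h₁, h₂, h₃, ih, ← tensorMat_mul, Matrix.mul_smul]
    split_ifs
    · rw [PauliHam.term, Matrix.smul_mul, smul_smul, mul_comm, pauliOp_eq_tensorMat]
    · rw [tensorMat_one, one_mul, one_mul]

/-- Multiplying Paulis adds their exponents mod 2 and keeps the phase unimodular. Over all terms the
exponents are the syndrome bits of site `j`. -/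
theorem siteFactor_eq_smul_bellMat (y : Bits (Fin m)) (l : List (Fin m)) (j : Fin n) :
    ∃ c : ℂ, c * star c = 1 ∧ siteFactor H y l j =
      c • bellMat (l.map fun i => (H.P i j).xBit * y i).sum
        (l.map fun i => (H.P i j).zBit * y i).sum := by
  induction l with
  | nil => exact ⟨1, by simp, by simp [siteFactor, bellMat_zero]⟩
  | cons a l ih =>
    obtain ⟨c, hc, h⟩ := ih
    have h₃ : siteFactor H y (a :: l) j =
      (if y a = 1 then (H.P a j).mat else 1) * siteFactor H y l j := by
      simp [siteFactor]
    obtain ⟨d, hd, hP⟩ := (H.P a j).mat_eq_smul_bellMat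
    rcases zmod_two_cases (y a) with hy | hy
    · exact ⟨c, hc, by simp [h₃, hy, h]⟩
    · rw [h₃, if_pos hy, h, hP, Matrix.smul_mul, Matrix.mul_smul, bellMat_mul]
      simp only [smul_smul, List.map_cons, List.sum_cons, hy, mul_one]
      refine ⟨_, ?_, rfl⟩
      have hs : ∀ e : ℂ, e * star e = 1 → (d * (c * e)) * star (d * (c * e)) = 1 := fun e he => by
        simp only [star_mul]
        linear_combination hd * (c * star c) * (e * star e) + hc * (e * star e) + he
      refine hs _ ?_
      split_ifs <;> simp

theorem siteFactor_eq_smul_bellMat_syndrome (y : Bits (Fin m)) (j : Fin n) :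
    ∃ c : ℂ, c * star c = 1 ∧ siteFactor H y (List.finRange m) j =
      c • bellMat ((H.checkMatrix *ᵥ y) (Sum.inl j)) ((H.checkMatrix *ᵥ y) (Sum.inr j)) := by
  obtain ⟨c, hc, h⟩ := siteFactor_eq_smul_bellMat H y (List.finRange m) j
  refine ⟨c, hc, h.trans ?_⟩
  rw [← Fin.sum_univ_def, ← Fin.sum_univ_def]
  rfl

theorem signProd_mul_star (y : Bits (Fin m)) (l : List (Fin m)) :
    signProd H y l * star (signProd H y l) = 1 := by
  induction l with
  | nil => simp [signProd]
  | cons a l ih =>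
    have h₂ : signProd H y (a :: l) =
      (if y a = 1 then ((H.v a : ℤ) : ℂ) else 1) * signProd H y l := by simp [signProd]
    have hs : ∀ e : ℂ, e * star e = 1 →
        (e * signProd H y l) * star (e * signProd H y l) = 1 := fun e he => by
      simp only [star_mul]
      linear_combination he * (signProd H y l * star (signProd H y l)) + ih
    rw [h₂]
    refine hs _ ?_
    rcases Int.units_eq_one_or (H.v a) with h | h <;> split_ifs <;> simp [h]

theorem trace_termProd_mul (y y' : Bits (Fin m)) :
    (termProd H y (List.finRange m) * (termProd H y' (List.finRange m))ᴴ).trace =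
      signProd H y (List.finRange m) * star (signProd H y' (List.finRange m)) *
      ∏ j, (siteFactor H y (List.finRange m) j * (siteFactor H y' (List.finRange m) j)ᴴ).trace := by
  simp only [termProd_eq_tensorMat, Matrix.conjTranspose_smul, Matrix.smul_mul, Matrix.mul_smul,
    Matrix.trace_smul, tensorMat_conjTranspose, tensorMat_mul, tensorMat_trace, smul_eq_mul]
  ring

theorem trace_termProd_mul_self (y : Bits (Fin m)) :
    (termProd H y (List.finRange m) * (termProd H y (List.finRange m))ᴴ).trace = 2 ^ n := by
  rw [trace_termProd_mul, signProd_mul_star, one_mul]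
  rw [Finset.prod_congr rfl (g := fun _ => (2 : ℂ)) fun j _ => ?_]
  · simp
  · obtain ⟨c, hc, h⟩ := siteFactor_eq_smul_bellMat_syndrome H y j
    rw [h, Matrix.conjTranspose_smul, Matrix.smul_mul, Matrix.mul_smul, smul_smul, hc, one_smul,
      bellMat_trace_mul_self]

/-- The trace factors over the sites, and it vanishes at any site where the syndromes differ. -/
theorem trace_termProd_mul_of_ne {y y' : Bits (Fin m)}
    (hne : H.checkMatrix *ᵥ y ≠ H.checkMatrix *ᵥ y') :
    (termProd H y (List.finRange m) * (termProd H y' (List.finRange m))ᴴ).trace = 0 := by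
  obtain ⟨j, hj⟩ : ∃ j, (H.checkMatrix *ᵥ y) (Sum.inl j) ≠ (H.checkMatrix *ᵥ y') (Sum.inl j) ∨
      (H.checkMatrix *ᵥ y) (Sum.inr j) ≠ (H.checkMatrix *ᵥ y') (Sum.inr j) := by
    obtain ⟨r, hr⟩ := Function.ne_iff.mp hne
    rcases r with j | j
    · exact ⟨j, Or.inl hr⟩
    · exact ⟨j, Or.inr hr⟩
  rw [trace_termProd_mul, Finset.prod_eq_zero (Finset.mem_univ j), mul_zero]
  obtain ⟨c, -, h⟩ := siteFactor_eq_smul_bellMat_syndrome H y j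
  obtain ⟨c', -, h'⟩ := siteFactor_eq_smul_bellMat_syndrome H y' j
  rw [h, h', Matrix.conjTranspose_smul, Matrix.smul_mul, Matrix.mul_smul, smul_smul,
    Matrix.trace_smul, bellMat_trace_mul_of_ne _ _ _ _ hj, smul_zero]

end PauliAlgebra

/-! ### Sorting words and the expansion of f(H) -/

section Words

variable {n m : ℕ}

/-- The number of occurrences of each letter in a word. -/
def letterCount {k : ℕ} (τ : Fin k → Fin m) (i : Fin m) : ℕ :=
  (Finset.univ.filter fun a => τ a = i).card

/-- The parities of the numbers of occurrences of the letters in a word. -/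
def wordParity {k : ℕ} (τ : Fin k → Fin m) : Bits (Fin m) := fun i => (letterCount τ i : ZMod 2)

theorem sum_letterCount {k : ℕ} (τ : Fin k → Fin m) : ∑ i, letterCount τ i = k := by
  have := Finset.card_eq_sum_card_fiberwise (s := Finset.univ) (t := Finset.univ) (f := τ)
    fun _ _ => by simp
  rw [Finset.card_univ, Fintype.card_fin] at this
  exact this.symm

/-- The multinomial coefficient cancels the normalization of the average, leaving a plain signed
count of words. -/
theorem multinomial_mul_antisymChar (G : SimpleGraph (Fin m)) (μ : Fin m → ℕ) :
    (Nat.multinomial Finset.univ μ : ℝ) * antisymChar G μ = ∑ τ ∈ words μ, sortSign G τ := by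
  have h : (∏ i, ((μ i).factorial : ℝ)) * (Nat.multinomial Finset.univ μ : ℝ) =
      ((∑ i, μ i).factorial : ℝ) := by
    exact_mod_cast Nat.multinomial_spec Finset.univ μ
  have h0 : ((∑ i, μ i).factorial : ℝ) ≠ 0 := by positivity
  rw [antisymChar, ← mul_assoc, ← mul_div_assoc, mul_comm (Nat.multinomial _ _ : ℝ), h,
    div_self h0, one_mul]

theorem sum_words_eq (G : SimpleGraph (Fin m)) (μ : Fin m → ℕ) {k : ℕ} (hk : ∑ i, μ i = k) :
    ∑ τ ∈ words μ, sortSign G τ =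
      ∑ τ : Fin k → Fin m with letterCount τ = μ, sortSign G τ := by
  subst hk
  refine Finset.sum_congr ?_ fun _ _ => rfl
  ext τ
  simp [words, letterCount, funext_iff]

theorem beta_eq_sum (G : SimpleGraph (Fin m)) (k : ℕ) (y : Bits (Fin m)) :
    beta G k y = ∑ τ : Fin k → Fin m with wordParity τ = y, sortSign G τ := by
  rw [beta, ← Finset.sum_fiberwise_of_maps_to (g := letterCount)
    (t := (Finset.piAntidiag (Finset.univ : Finset (Fin m)) k).filter
      (fun μ => ∀ i, (μ i : ZMod 2) = y i))]
  · refine Finset.sum_congr rfl fun μ hμ => ?_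
    rw [Finset.mem_filter, Finset.mem_piAntidiag] at hμ
    rw [multinomial_mul_antisymChar, sum_words_eq G μ hμ.1.1, Finset.filter_filter]
    refine Finset.sum_congr ?_ fun _ _ => rfl
    ext τ
    simp only [Finset.mem_filter, Finset.mem_univ, true_and]
    refine ⟨fun h => ⟨?_, h⟩, fun h => h.2⟩
    funext i
    rw [wordParity, h]
    exact hμ.2 i
  · intro τ hτ
    rw [Finset.mem_filter] at hτ
    rw [Finset.mem_filter, Finset.mem_piAntidiag]
    exact ⟨⟨sum_letterCount τ, fun i _ => Finset.mem_univ i⟩, fun i => congrFun hτ.2 i⟩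

/-- A letter of odd multiplicity occurs at least once. -/
theorem hammingNorm_wordParity_le {k : ℕ} (τ : Fin k → Fin m) :
    hammingNorm (wordParity τ) ≤ k := by
  calc hammingNorm (wordParity τ)
      = ∑ i : Fin m, if wordParity τ i ≠ 0 then 1 else 0 := by
        simp [hammingNorm, Finset.card_filter]
    _ ≤ ∑ i, letterCount τ i := by
        refine Finset.sum_le_sum fun i _ => ?_
        split_ifs with h
        · refine Nat.one_le_iff_ne_zero.mpr fun h0 => h ?_
          simp [wordParity, h0]
        · exact Nat.zero_le _
    _ = k := sum_letterCount τ

theorem beta_eq_zero (G : SimpleGraph (Fin m)) {k : ℕ} {y : Bits (Fin m)}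
    (hy : k < hammingNorm y) : beta G k y = 0 := by
  rw [beta_eq_sum, Finset.filter_false_of_mem, Finset.sum_empty]
  rintro τ - rfl
  exact absurd (hammingNorm_wordParity_le τ) (by omega)

theorem wordParity_cons {k : ℕ} (i : Fin m) (τ : Fin k → Fin m) :
    wordParity (Fin.cons i τ : Fin (k + 1) → Fin m) = Pi.single i 1 + wordParity τ := by
  funext j
  simp only [wordParity, letterCount, Finset.card_filter, Fin.sum_univ_succ, Fin.cons_zero,
    Fin.cons_succ, Pi.add_apply, Pi.single_apply, Nat.cast_add]
  congr 1
  simp [eq_comm]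

open Classical in
/-- The sign of moving the variable `i` to its place in the ordered product selected by `y`. -/
noncomputable def insertSign (G : SimpleGraph (Fin m)) (i : Fin m) (y : Bits (Fin m))
    (l : List (Fin m)) : ℝ :=
  (l.map fun j => if j < i ∧ G.Adj i j ∧ y j = 1 then (-1 : ℝ) else 1).prod

open Classical in
theorem sortSign_eq_prod (G : SimpleGraph (Fin m)) {k : ℕ} (τ : Fin k → Fin m) :
    sortSign G τ = ∏ a, ∏ b,
      if a < b ∧ τ b < τ a ∧ G.Adj (τ a) (τ b) then (-1 : ℝ) else 1 := by
  rw [sortSign, ← Fintype.prod_prod_type', Finset.prod_ite]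
  simp

theorem neg_one_pow_eq_ite (c : ℕ) : (-1 : ℝ) ^ c = if (c : ZMod 2) = 1 then -1 else 1 := by
  rcases Nat.even_or_odd c with h | h
  · rw [h.neg_one_pow, (ZMod.natCast_eq_zero_iff_even).mpr h]; simp
  · rw [h.neg_one_pow, (ZMod.natCast_eq_one_iff_odd).mpr h]; simp

-- The new inversions pair the leading `i` with later smaller adjacent letters. Each occurrence of a
-- letter gives one factor -1, so only the parity of its count matters.
open Classical in
theorem sortSign_cons (G : SimpleGraph (Fin m)) {k : ℕ} (i : Fin m) (τ : Fin k → Fin m) :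
    sortSign G (Fin.cons i τ : Fin (k + 1) → Fin m) =
      insertSign G i (wordParity τ) (List.finRange m) * sortSign G τ := by
  simp only [sortSign_eq_prod, Fin.prod_univ_succ, Fin.cons_zero, Fin.cons_succ]
  simp only [lt_self_iff_false, false_and, if_false, one_mul, Fin.succ_pos, true_and,
    Fin.not_lt_zero, Fin.succ_lt_succ_iff]
  congr 1
  rw [insertSign, ← Fin.prod_univ_def, ← Finset.prod_fiberwise (g := τ)]
  refine Finset.prod_congr rfl fun j _ => ?_
  rw [Finset.prod_congr rfl (g := fun _ => if j < i ∧ G.Adj i j then (-1 : ℝ) else 1)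
    fun a ha => by rw [(Finset.mem_filter.mp ha).2]]
  rw [Finset.prod_const]
  by_cases h : j < i ∧ G.Adj i j
  · rw [if_pos h, neg_one_pow_eq_ite]
    simp only [h.1, h.2, true_and]
    rfl
  · rw [if_neg h, one_pow, if_neg fun h' => h ⟨h'.1, h'.2.1⟩]

variable (H : PauliHam n m)

theorem termProd_cons (y : Bits (Fin m)) (a : Fin m) (l : List (Fin m)) :
    termProd H y (a :: l) = (if y a = 1 then H.term a else 1) * termProd H y l := by
  simp [termProd]

theorem termProd_congr {y y' : Bits (Fin m)} {l : List (Fin m)} (h : ∀ j ∈ l, y j = y' j) :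
    termProd H y l = termProd H y' l := by
  unfold termProd
  congr 1
  exact List.map_congr_left fun j hj => by rw [h j hj]

theorem insertSign_of_le (G : SimpleGraph (Fin m)) {i : Fin m} (y : Bits (Fin m))
    {l : List (Fin m)} (h : ∀ j ∈ l, i ≤ j) : insertSign G i y l = 1 := by
  unfold insertSign
  refine List.prod_eq_one fun r hr => ?_
  obtain ⟨j, hj, rfl⟩ := List.mem_map.mp hr
  exact if_neg fun h' => (h j hj).not_gt h'.1

/-- Moving the term `i` rightwards to its sorted place crosses exactly the selected smaller terms.
There it toggles bit `i`, by being inserted or by cancelling its own copy. -/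
theorem term_mul_termProd {i : Fin m} (y : Bits (Fin m)) {l : List (Fin m)}
    (hl : l.Pairwise (· < ·)) (hi : i ∈ l) :
    H.term i * termProd H y l =
      insertSign H.antiGraph i y l • termProd H (Pi.single i 1 + y) l := by
  classical
  induction l with
  | nil => simp at hi
  | cons a l ih =>
    rw [List.pairwise_cons] at hl
    rcases eq_or_ne i a with rfl | hia
    -- The term is already in place: all letters of the list are at least `i`, so nothing is
    -- crossed.
    · rw [insertSign_of_le _ _ fun j hj => ?_, one_smul, termProd_cons, termProd_cons,
        termProd_congr H (y := y) (y' := Pi.single i 1 + y) (l := l) fun j hj => ?_]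
      · rw [← Matrix.mul_assoc]
        congr 1
        rcases zmod_two_cases (y i) with hy | hy
        · simp [hy]
        · simp [hy, H.term_mul_self, show (1 : ZMod 2) + 1 = 0 from rfl]
      · simp [(hl.1 j hj).ne']
      · rcases List.mem_cons.mp hj with rfl | hj
        · exact le_rfl
        · exact (hl.1 j hj).le
    · have hil : i ∈ l := (List.mem_cons.mp hi).resolve_left hia
      have hai : a < i := hl.1 i hil
      have hs : insertSign H.antiGraph i y (a :: l) =
          (if a < i ∧ H.antiGraph.Adj i a ∧ y a = 1 then (-1 : ℝ) else 1) *
            insertSign H.antiGraph i y l := by simp [insertSign]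
      have hya : (Pi.single i 1 + y : Bits (Fin m)) a = y a := by simp [hia.symm]
      rw [termProd_cons, termProd_cons, hya, hs, mul_smul, ← Matrix.mul_smul, ← ih hl.2 hil,
        ← Matrix.mul_assoc, ← Matrix.mul_assoc, ← Matrix.smul_mul]
      congr 1
      by_cases hy : y a = 1
      · rw [if_pos hy, H.term_mul_comm hia]
        simp [hai, hy]
      · simp [hy]

/-- Prepending a letter to a word multiplies by a term from the left, and `sortSign_cons` records
precisely the sign this produces. -/
theorem op_pow_eq_sum (k : ℕ) :
    H.op ^ k = ∑ τ : Fin k → Fin m,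
      sortSign H.antiGraph τ • termProd H (wordParity τ) (List.finRange m) := by
  induction k with
  | zero =>
    rw [Fintype.sum_unique]
    have h0 : wordParity (default : Fin 0 → Fin m) = 0 := by
      funext i; simp [wordParity, letterCount]
    simp [sortSign_eq_prod, h0, termProd]
  | succ k ih =>
    rw [pow_succ', ih, PauliHam.op, ← (Fin.consEquiv fun _ => Fin m).sum_comp,
      Fintype.sum_prod_type, Finset.sum_mul]
    refine Finset.sum_congr rfl fun i _ => ?_
    rw [Finset.mul_sum]
    refine Finset.sum_congr rfl fun τ _ => ?_
    rw [Matrix.mul_smul, term_mul_termProd H _ (List.pairwise_lt_finRange m) (List.mem_finRange i)]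
    simp only [Fin.consEquiv, Equiv.coe_fn_mk]
    rw [sortSign_cons, wordParity_cons, smul_smul, mul_comm]

theorem op_pow_eq_sum_beta (k : ℕ) :
    H.op ^ k = ∑ y, beta H.antiGraph k y • termProd H y (List.finRange m) := by
  rw [op_pow_eq_sum, ← Finset.sum_fiberwise (g := wordParity)]
  refine Finset.sum_congr rfl fun y _ => ?_
  rw [beta_eq_sum, Finset.sum_smul]
  exact Finset.sum_congr rfl fun τ hτ => by rw [(Finset.mem_filter.mp hτ).2]

theorem poly_eq_sum_pilotVec {f : Polynomial ℝ} {ℓ : ℕ} (hf : f.natDegree ≤ ℓ) :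
    H.poly f = ∑ y, pilotVec H f ℓ y • termProd H y (List.finRange m) := by
  rw [PauliHam.poly, Polynomial.aeval_eq_sum_range' (Nat.lt_succ_of_le hf)]
  simp only [op_pow_eq_sum_beta, Finset.smul_sum, smul_smul, pilotVec, Complex.coe_smul,
    Finset.sum_smul]
  exact Finset.sum_comm

theorem pilotVec_eq_zero (f : Polynomial ℝ) {ℓ : ℕ} {y : Bits (Fin m)} (hy : ℓ < hammingNorm y) :
    pilotVec H f ℓ y = 0 := by
  simp only [pilotVec]
  rw [Finset.sum_eq_zero fun k hk => ?_, Complex.ofReal_zero]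
  rw [beta_eq_zero _ (by rw [Finset.mem_range] at hk; omega), mul_zero]

end Words

/-! ### Action of the algorithm, normalization and reduced state -/

section Correctness

variable {n m : ℕ} (H : PauliHam n m)

theorem siteBell_smul (c : ℂ) (A : Matrix (ZMod 2) (ZMod 2) ℂ) :
    siteBell (c • A) = c • siteBell A := by
  have h : cnotBC (c • A) = c • cnotBC A := rfl
  rw [siteBell, h, Matrix.mul_smul, Matrix.transpose_smul]
  rfl

theorem tensorABC_smul_right (φ : StateVec (Fin m)) (c : ℂ) (χ : StateVec (Fin n ⊕ Fin n)) :
    tensorABC φ (c • χ) = c • tensorABC φ χ := by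
  funext x
  simp only [tensorABC, Pi.smul_apply, smul_eq_mul]
  ring

theorem tensorABC_sum_right {ι : Type*} (t : Finset ι) (φ : StateVec (Fin m))
    (χ : ι → StateVec (Fin n ⊕ Fin n)) :
    tensorABC φ (∑ i ∈ t, χ i) = ∑ i ∈ t, tensorABC φ (χ i) := by
  funext x
  simp [tensorABC, Finset.mul_sum]

theorem tensorABC_ket_ket (y : Bits (Fin m)) (s : Bits (Fin n ⊕ Fin n)) :
    tensorABC (ket y) (ket s) = ket (Sum.elim y s) := by
  funext x
  simp only [tensorABC, ket, Pi.single_apply, ← ite_and, mul_ite, mul_one, mul_zero]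
  refine if_congr ⟨fun h => ?_, fun h => by subst h; exact ⟨rfl, rfl⟩⟩ rfl rfl
  rw [← h.1, ← h.2]
  exact (Sum.elim_comp_inl_inr x).symm

theorem tensorABC_eq_sum (R : StateVec (Fin m)) (χ : StateVec (Fin n ⊕ Fin n)) :
    tensorABC R χ = ∑ y, R y • tensorABC (ket y) χ := by
  funext x
  simp [tensorABC, ket, Pi.single_apply]

/-- After the coherent Bell measurement, registers `BC` hold the syndrome of `y`. -/
theorem siteProd_siteBell_eq_smul_ket (y : Bits (Fin m)) :
    ∃ c : ℂ, siteProd (fun j => siteBell (siteFactor H y (List.finRange m) j * sitePhi)) =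
      c • ket (H.checkMatrix *ᵥ y) := by
  choose c _ h using siteFactor_eq_smul_bellMat_syndrome H y
  simp only [h, Matrix.smul_mul, siteBell_smul, siteBell_bellMat, smul_smul]
  exact ⟨_, by rw [siteProd_smul, siteProd_siteKet]⟩

variable {D : Matrix (Bits (Qubit n m)) (Bits (Qubit n m)) ℂ} {ℓ : ℕ}

/-- The measured state is a scalar multiple of a basis state, and the scalar passes through `D`. The
`siteBell` form is kept so that the inverse measurement applies directly. -/
theorem IsDecodingOracle.mulVec_prodState {H} (hD : IsDecodingOracle H ℓ D) {y : Bits (Fin m)}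
    (hy : hammingNorm y ≤ ℓ) :
    D *ᵥ prodState y (fun j => siteBell (siteFactor H y (List.finRange m) j * sitePhi)) =
      prodState 0 fun j => siteBell (siteFactor H y (List.finRange m) j * sitePhi) := by
  obtain ⟨c, hc⟩ := siteProd_siteBell_eq_smul_ket H y
  simp only [prodState, hc, tensorABC_smul_right, tensorABC_ket_ket, Matrix.mulVec_smul,
    hD.2 y hy]

theorem IsDecodingOracle.hdqi_act_ket {H} (hD : IsDecodingOracle H ℓ D) {y : Bits (Fin m)}
    (hy : hammingNorm y ≤ ℓ) :
    hdqi.act H D none none (tensorABC (ket y) (ket 0)) =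
      tensorABC (ket 0) (applyB (termProd H y (List.finRange m)) (maxEntangled n)) := by
  have hO : Prog.oracle.act H D none none = D.mulVecLin := rfl
  simp only [hdqi, Prog.act.eq_1, Module.End.mul_apply, act_preparePhi]
  rw [prodState, act_applySigns, ← prodState]
  simp only [map_smul, act_controlledPaulis, act_bellMeasure, hO, Matrix.mulVecLin_apply,
    hD.mulVec_prodState hy, act_bellUnmeasure]
  rw [termProd_eq_tensorMat, applyB_smul, tensorABC_smul_right, ← siteProd_sitePhi,
    applyB_tensorMat_siteProd, prodState]

/-- Equal syndromes give the same oracle output, and a unitary is injective. -/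
theorem IsDecodingOracle.syndrome_injOn {H} (hD : IsDecodingOracle H ℓ D) {y y' : Bits (Fin m)}
    (hy : hammingNorm y ≤ ℓ) (hy' : hammingNorm y' ≤ ℓ)
    (h : H.checkMatrix *ᵥ y = H.checkMatrix *ᵥ y') : y = y' := by
  have h₁ := (hD.2 y hy).trans ((congrArg (fun s => ket (Sum.elim 0 s)) h).trans (hD.2 y' hy').symm)
  have h₂ := congrArg (star D *ᵥ ·) h₁
  simp only [Matrix.mulVec_mulVec, Matrix.mem_unitaryGroup_iff'.mp hD.1, Matrix.one_mulVec] at h₂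
  have h₃ : Sum.elim y (H.checkMatrix *ᵥ y) = Sum.elim y' (H.checkMatrix *ᵥ y') := by
    by_contra hne
    have h₄ := congrFun h₂ (Sum.elim y (H.checkMatrix *ᵥ y))
    simp only [ket, Pi.single_eq_same, Pi.single_eq_of_ne hne] at h₄
    exact one_ne_zero h₄
  funext i
  exact congrFun h₃ (Sum.inl i)

theorem pilot_smul_poly {f : Polynomial ℝ} (hf : f.natDegree ≤ ℓ) {R : StateVec (Fin m)} {N : ℂ}
    (hR : R = N⁻¹ • pilotVec H f ℓ) :
    N⁻¹ • H.poly f = ∑ y, R y • termProd H y (List.finRange m) := by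
  rw [poly_eq_sum_pilotVec H hf, Finset.smul_sum]
  simp only [hR, Pi.smul_apply, smul_assoc]

theorem IsDecodingOracle.hdqi_act_pilot {H} (hD : IsDecodingOracle H ℓ D) {f : Polynomial ℝ}
    (hf : f.natDegree ≤ ℓ) {R : StateVec (Fin m)} {N : ℂ} (hR : R = N⁻¹ • pilotVec H f ℓ) :
    hdqi.act H D none none (tensorABC R (ket 0)) =
      tensorABC (ket 0) (N⁻¹ • applyB (H.poly f) (maxEntangled n)) := by
  rw [← applyB_smul, pilot_smul_poly H hf hR, applyB_sum, tensorABC_sum_right,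
    tensorABC_eq_sum R, map_sum]
  refine Finset.sum_congr rfl fun y _ => ?_
  rw [map_smul, applyB_smul, tensorABC_smul_right]
  by_cases hy : hammingNorm y ≤ ℓ
  · rw [hD.hdqi_act_ket hy]
  -- Inputs on which the oracle is unconstrained carry no amplitude.
  · have : R y = 0 := by simp [hR, pilotVec_eq_zero H f (not_le.mp hy)]
    rw [this, zero_smul, zero_smul]

/-- Pythagoras for the trace inner product: the operators with nonzero coefficient have distinct
syndromes, hence are orthogonal, each of squared norm 2^n. -/
theorem IsDecodingOracle.trace_sq {H} (hD : IsDecodingOracle H ℓ D) {f : Polynomial ℝ}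
    (hf : f.natDegree ≤ ℓ) {R : StateVec (Fin m)} {N : ℂ} (hR : R = N⁻¹ • pilotVec H f ℓ)
    (hnorm : ∑ y, ‖R y‖ ^ 2 = 1) :
    N⁻¹ * star N⁻¹ * (H.poly f ^ 2).trace = 2 ^ n := by
  have h : N⁻¹ * star N⁻¹ * (H.poly f ^ 2).trace =
      ((N⁻¹ • H.poly f) * (N⁻¹ • H.poly f)ᴴ).trace := by
    rw [Matrix.conjTranspose_smul, H.poly_conjTranspose, Matrix.smul_mul, Matrix.mul_smul,
      smul_smul, Matrix.trace_smul, smul_eq_mul, sq]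
  rw [h, pilot_smul_poly H hf hR, Matrix.conjTranspose_sum, Finset.sum_mul, Matrix.trace_sum]
  have hrow : ∀ y : Bits (Fin m), ((R y • termProd H y (List.finRange m)) *
      ∑ y', (R y' • termProd H y' (List.finRange m))ᴴ).trace =
        ((‖R y‖ ^ 2 : ℝ) : ℂ) * 2 ^ n := by
    intro y
    rw [Finset.mul_sum, Matrix.trace_sum]
    rw [Finset.sum_eq_single y]
    · rw [Matrix.conjTranspose_smul, Matrix.smul_mul, Matrix.mul_smul, smul_smul,
        Matrix.trace_smul, trace_termProd_mul_self, smul_eq_mul]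
      congr 1
      rw [Complex.ofReal_pow]
      exact Complex.mul_conj' (R y)
    · intro y' _ hne
      rw [Matrix.conjTranspose_smul, Matrix.smul_mul, Matrix.mul_smul, smul_smul,
        Matrix.trace_smul, smul_eq_mul]
      have hz : ∀ y : Bits (Fin m), ¬ hammingNorm y ≤ ℓ → R y = 0 := fun y hy => by
        simp [hR, pilotVec_eq_zero H f (not_le.mp hy)]
      by_cases hy : hammingNorm y ≤ ℓ
      · by_cases hy' : hammingNorm y' ≤ ℓ
        · rw [trace_termProd_mul_of_ne H fun hs => hne (hD.syndrome_injOn hy hy' hs).symm,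
            mul_zero]
        · rw [hz y' hy', star_zero, mul_zero, zero_mul]
      · rw [hz y hy, zero_mul, zero_mul]
    · exact fun hy => absurd (Finset.mem_univ y) hy
  rw [Finset.sum_congr rfl fun y _ => hrow y, ← Finset.sum_mul, ← Complex.ofReal_sum, hnorm,
    Complex.ofReal_one, one_mul]

theorem applyB_maxEntangled (M : Matrix (Bits (Fin n)) (Bits (Fin n)) ℂ) (b c : Bits (Fin n)) :
    applyB M (maxEntangled n) (Sum.elim b c) = M b c * (((Real.sqrt 2) ^ n : ℝ) : ℂ)⁻¹ := by
  simp [applyB, maxEntangled]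

/-- Up to the factor 2^(-n/2), the amplitudes of (M ⊗ I)|Φⁿ⟩ are the entries of `M`, so summing over
`C` forms M Mᴴ. -/
theorem reducedB_applyB (c : ℂ) (M : Matrix (Bits (Fin n)) (Bits (Fin n)) ℂ) :
    reducedB (tensorABC (ket (0 : Bits (Fin m))) (c • applyB M (maxEntangled n))) =
      (c * star c * (2 ^ n)⁻¹) • (M * Mᴴ) := by
  have h2 : (((Real.sqrt 2) ^ n : ℝ) : ℂ)⁻¹ * star (((Real.sqrt 2) ^ n : ℝ) : ℂ)⁻¹ =
      (2 ^ n)⁻¹ := by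
    rw [star_inv₀, ← mul_inv]
    congr 1
    rw [Complex.star_def, Complex.conj_ofReal, ← Complex.ofReal_mul, ← mul_pow,
      Real.mul_self_sqrt (by norm_num)]
    norm_num
  ext b b'
  have hval : ∀ (a : Bits (Fin m)) (b c' : Bits (Fin n)),
      tensorABC (ket (0 : Bits (Fin m))) (c • applyB M (maxEntangled n))
        (Sum.elim a (Sum.elim b c')) =
      if a = 0 then c * (M b c' * (((Real.sqrt 2) ^ n : ℝ) : ℂ)⁻¹) else 0 := by
    intro a b c'
    have : tensorABC (ket (0 : Bits (Fin m))) (c • applyB M (maxEntangled n))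
        (Sum.elim a (Sum.elim b c')) =
      ket (0 : Bits (Fin m)) a * (c * applyB M (maxEntangled n) (Sum.elim b c')) := rfl
    rw [this, applyB_maxEntangled, ket, Pi.single_apply, ite_mul, one_mul, zero_mul]
  simp only [reducedB, Matrix.of_apply, hval]
  rw [Finset.sum_eq_single 0 (fun a _ ha => by simp [ha]) fun h => absurd (Finset.mem_univ _) h]
  simp only [if_true, Matrix.smul_apply, Matrix.mul_apply, Matrix.conjTranspose_apply, smul_eq_mul,
    Finset.mul_sum, star_mul]
  refine Finset.sum_congr rfl fun c' _ => ?_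
  linear_combination (c * star c * M b c' * star (M b' c')) * h2

end Correctness

end HDQI

open HDQI
theorem theorem5p2 :
    -- running time: if `m = poly(n)`, then the algorithm runs in time `poly(n)`
    (∀ a : Polynomial ℕ, ∃ q : Polynomial ℕ,
      ∀ (n m : ℕ) (H : PauliHam n m)
        (D : Matrix (Bits (Qubit n m)) (Bits (Qubit n m)) ℂ) (ψ : StateVec (Qubit n m)),
        m ≤ a.eval n → (hdqi.run H D ψ).time ≤ q.eval n) ∧
    -- correctness, with a single oracle call
    (∀ (n m ℓ : ℕ) (H : PauliHam n m)
      (D : Matrix (Bits (Qubit n m)) (Bits (Qubit n m)) ℂ) (f : Polynomial ℝ)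
      (R : StateVec (Fin m)) (N : ℂ),
      IsDecodingOracle H ℓ D →
      f.natDegree ≤ ℓ →
      ℓ ≤ m →
      R = N⁻¹ • pilotVec H f ℓ →
      ∑ y, ‖R y‖ ^ 2 = 1 →
        (hdqi.run H D (tensorABC R (ket 0))).calls = 1 ∧
        (hdqi.run H D (tensorABC R (ket 0))).ψ =
          tensorABC (ket 0) (N⁻¹ • applyB (H.poly f) (maxEntangled n)) ∧
        (H.poly f ^ 2).trace ≠ 0 ∧
        reducedB (hdqi.run H D (tensorABC R (ket 0))).ψ = H.rho f) := by
  refine ⟨hdqi_polynomial_time, fun n m ℓ H D f R N hD hf _ hR hnorm => ?_⟩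
  have hψ : (hdqi.run H D (tensorABC R (ket 0))).ψ =
      tensorABC (ket 0) (N⁻¹ • applyB (H.poly f) (maxEntangled n)) :=
    (exec_state H D hdqi none none _).trans (hD.hdqi_act_pilot hf hR)
  have htr := hD.trace_sq hf hR hnorm
  have h2 : (2 : ℂ) ^ n ≠ 0 := pow_ne_zero _ two_ne_zero
  have hT : (H.poly f ^ 2).trace ≠ 0 := fun h0 => h2 (by rw [← htr, h0, mul_zero])
  refine ⟨hdqi_calls H D _, hψ, hT, ?_⟩
  rw [hψ, reducedB_applyB, H.poly_conjTranspose, ← sq, PauliHam.rho]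
  congr 1
  -- Replacing 2^n by |N|⁻² Tr f(H)² cancels N. That |N|⁻² ≠ 0 also follows from this identity,
  -- since 2^n ≠ 0.
  rw [← htr]
  rw [← htr] at h2
  have h3 := left_ne_zero_of_mul h2
  rw [mul_inv, ← mul_assoc, mul_inv_cancel₀ h3, one_mul]
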